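/- Let $\mathbb F$ be a field. A persistence module $V$ here is a functor from the ordered set $\mathbb Z$ to finite-dimensional $\mathbb F$-vector spaces with $V_t=0$ for all but finitely many $t$ (that is, up to translation, a pointwise finite-dimensional module indexed by $\{0,\dots,l\}$ and extended by zero); its inner morphisms are $v_{s,t}\colon V_s\to V_t$, $s\le t$. For $\delta\in\mathbb Z$ the shift $V(\delta)$ is given by $V(\delta)_t=V_{t+\delta}$, and for an interval $J=[i,j]$ with $i\le j$ in $\mathbb Z$ put $J(\delta)=[i-\delta,j-\delta]$ and $|J|=j-i$. Write $k_J$ for the interval module of $J$, and $J\in\mathrm{Barc}(V)$ if $k_J$ appears in the interval decomposition $V\cong\bigoplus_J k_J^{\mu_J}$. Write $[i_1,j_1]\preceq[i_2,j_2]$ if $i_1\le i_2\le j_1\le j_2$, and say that $[a,b]$ is strictly nested in $[c,d]$ if $c<a\le b<d$. The nestedness $\Xi(V)\in(0,\infty]$ is the minimum of $\min\{|a-c|,|b-d|\}$ over all pairs $[a,b],[c,d]\in\mathrm{Barc}(V)$ with $[a,b]$ strictly nested in $[c,d]$ (and $\infty$ if there is no such pair). A $\delta$-interleaving pair ($\delta\in\mathbb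 N$) between $V$ and $W$ consists of morphisms $\Phi\colon V\to W(\delta)$ and $\Psi\colon W\to V(\delta)$ with $\Psi_{t+\delta}\circ\Phi_t=v_{t,t+2\delta}$ and $\Phi_{t+\delta}\circ\Psi_t=w_{t,t+2\delta}$ for all $t$. A morphism $\Phi\colon V\to W$ is regarded as the ladder module $(V,W,\Phi)$, isomorphisms being pairs of isomorphisms of the sources and of the targets that commute with the morphisms. For $K\preceq J$ let $\mathbf R_K^J$ be the ladder module $k_J\to k_K$ given by the identity at every index of $J\cap K$; let $\mathbf I^+_J$ be $k_J\to 0$ and $\mathbf I^-_K$ be $0\to k_K$. A ladder decomposition of $\Phi$ is an isomorphism $$(V,W,\Phi)\;\cong\;\bigoplus_{K\preceq J}\big(\mathbf R_K^J\big)^{r_K^J}\oplus\bigoplus_J\big(\mathbf I_J^+\big)^{d_J^+}\oplus\bigoplus_K\big(\mathbf I_K^-\big)^{d_K^-}$$ with $r_K^J,d_J^+,d_K^-\in\mathbb N$; put $r_K^J=0$ if $K\not\preceq J$. We say that $(\mathbf R_K^J)^\mu$ appears in the decomposition if $r_K^J=\mu$. **Theorem.** Let $(\Phi,\Psi)$ be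 a $\delta$-interleaving pair between $V$ and $W$ with $\delta<\tfrac12\min(\Xi(V),\Xi(W))$. Then $\Phi\colon V\to W(\delta)$ and $\Psi\colon W\to V(\delta)$ have ladder decompositions, and, for any ladder decomposition of $\Phi$ and any ladder decomposition of $\Psi$, for all bars $J_V\in\mathrm{Barc}(V)$ and $J_W\in\mathrm{Barc}(W)$ with $|J_V|,|J_W|\ge 2\delta$ and every $\mu\in\mathbb N$, the following are equivalent: * $(\mathbf R_{J_W(\delta)}^{J_V})^\mu$ appears in the ladder decomposition of $\Phi$; * $(\mathbf R_{J_V(\delta)}^{J_W})^\mu$ appears in the ladder decomposition of $\Psi$. -/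

import Mathlib

universe u v w v' w'

open scoped DirectSum

/-! ## Persistence modules over the integers -/

/-- A persistence module over the field `F`: a functor from the ordered set `ℤ` to `F`-vector
spaces. A module indexed by `{0, …, l}` is regarded as a `ℤ`-indexed one that is zero outside
`{0, …, l}`, so that shifts make sense (see `PersistenceModule.IsFinite`). -/
structure PersistenceModule (F : Type u) [Field F] where
  obj : ℤ → Type v
  [addCommGroup : ∀ t, AddCommGroup (obj t)]
  [module : ∀ t, Module F (obj t)]
  /-- the inner morphisms `v_{s,t}` -/
  map : ∀ {s t : ℤ}, s ≤ t → (obj s →ₗ[F] obj t)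
  map_self : ∀ t, map (le_refl t) = LinearMap.id
  map_comp : ∀ {r s t : ℤ} (h : r ≤ s) (h' : s ≤ t), map h' ∘ₗ map h = map (h.trans h')

namespace PersistenceModule

attribute [instance] addCommGroup module

variable {F : Type u} [Field F]

/-- Pointwise finite dimensional, and zero at all but finitely many indices. -/
structure IsFinite (V : PersistenceModule.{u, v} F) : Prop where
  finiteDimensional : ∀ t, FiniteDimensional F (V.obj t)
  bounded : ∃ a b : ℤ, ∀ t, t < a ∨ b < t → Subsingleton (V.obj t)

/-- The shift `V(d)`, with `V(d)_t = V_{t+d}`. -/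
@[reducible] def shift (V : PersistenceModule.{u, v} F) (d : ℤ) : PersistenceModule.{u, v} F where
  obj t := V.obj (t + d)
  map h := V.map (add_le_add_left h d)
  map_self t := V.map_self (t + d)
  map_comp h h' := V.map_comp (add_le_add_left h d) (add_le_add_left h' d)

/-- Morphisms of persistence modules. -/
structure Hom (V : PersistenceModule.{u, v} F) (W : PersistenceModule.{u, w} F) where
  app : ∀ t, V.obj t →ₗ[F] W.obj t
  naturality : ∀ {s t : ℤ} (h : s ≤ t), app t ∘ₗ V.map h = W.map h ∘ₗ app s

/-- Isomorphisms of persistence modules. -/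
structure Iso (V : PersistenceModule.{u, v} F) (W : PersistenceModule.{u, w} F) where
  app : ∀ t, V.obj t ≃ₗ[F] W.obj t
  naturality : ∀ {s t : ℤ} (h : s ≤ t) (x : V.obj s), app t (V.map h x) = W.map h (app s x)

/-- The zero persistence module. -/
def zero (F : Type u) [Field F] : PersistenceModule.{u, u} F where
  obj _ := PUnit
  map _ := 0
  map_self _ := by ext
  map_comp _ _ := by ext

/-- Direct sum of a family of persistence modules. -/
noncomputable def directSum {ι : Type} (M : ι → PersistenceModule.{u, v} F) :
    PersistenceModule.{u, v} F where
  obj t := ⨁ i, (M i).obj t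
  map h := DirectSum.lmap fun i => (M i).map h
  map_self t := by simp only [map_self, DirectSum.lmap_id]
  map_comp h h' := by simp only [← DirectSum.lmap_comp, map_comp]

/-! ## Intervals, interval modules and barcodes -/

/-- The bar `J(d) = [i - d, j - d]` for `J = [i, j]`. -/
def shiftBar (J : NonemptyInterval ℤ) (d : ℤ) : NonemptyInterval ℤ :=
  ⟨(J.fst - d, J.snd - d), sub_le_sub_right J.fst_le_snd d⟩

/-- The overlapping relation `[i₁, j₁] ⪯ [i₂, j₂]`, i.e. `i₁ ≤ i₂ ≤ j₁ ≤ j₂`. -/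
def Overlap (J₁ J₂ : NonemptyInterval ℤ) : Prop :=
  J₁.fst ≤ J₂.fst ∧ J₂.fst ≤ J₁.snd ∧ J₁.snd ≤ J₂.snd

/-- `J₁` is strictly nested in `J₂`: both endpoints of `J₁` lie strictly inside `J₂`. -/
def StrictlyNested (J₁ J₂ : NonemptyInterval ℤ) : Prop :=
  J₂.fst < J₁.fst ∧ J₁.snd < J₂.snd

open Classical in
/-- The field `F` if `p` holds, and `0` otherwise. -/
noncomputable def fieldIf (F : Type u) [Field F] (p : Prop) : Submodule F F :=
  if p then ⊤ else ⊥

open Classical in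
/-- The identity of `F` if both `p` and `q` hold, and `0` otherwise. -/
noncomputable def idIf (F : Type u) [Field F] (p q : Prop) : fieldIf F p →ₗ[F] fieldIf F q where
  toFun x := ⟨if q then (x : F) else 0, by
    by_cases hq : q
    · rw [if_pos hq, fieldIf, if_pos hq]
      exact Submodule.mem_top
    · rw [if_neg hq]
      exact (fieldIf F q).zero_mem⟩
  map_add' x y := by ext; by_cases hq : q <;> simp [hq]
  map_smul' c x := by ext; by_cases hq : q <;> simp [hq]

theorem fieldIf_eq_zero {p : Prop} (hp : ¬p) (x : fieldIf F p) : x = 0 := by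
  obtain ⟨x, hx⟩ := x
  rw [fieldIf, if_neg hp, Submodule.mem_bot] at hx
  exact Subtype.ext hx

theorem idIf_self (p : Prop) : idIf F p p = LinearMap.id := by
  ext x
  by_cases hp : p
  · simp [idIf, hp]
  · simp [fieldIf_eq_zero hp x]

theorem idIf_comp {p q r : Prop} (h : p → r → q) : idIf F q r ∘ₗ idIf F p q = idIf F p r := by
  ext x
  by_cases hp : p
  · by_cases hr : r
    · simp [idIf, hr, h hp hr]
    · simp [idIf, hr]
  · simp [fieldIf_eq_zero hp x]

theorem idIf_comp_eq {p q q' r : Prop} (h : p → r → (q ↔ q')) :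
    idIf F q r ∘ₗ idIf F p q = idIf F q' r ∘ₗ idIf F p q' := by
  ext x
  by_cases hp : p
  · by_cases hr : r
    · by_cases hq : q
      · simp [idIf, hr, hq, (h hp hr).1 hq]
      · simp [idIf, hr, hq, mt (h hp hr).2 hq]
    · simp [idIf, hr]
  · simp [fieldIf_eq_zero hp x]

/-- The interval module `k_J`. -/
noncomputable def interval (F : Type u) [Field F] (J : NonemptyInterval ℤ) :
    PersistenceModule.{u, u} F where
  obj t := fieldIf F (t ∈ J)
  map {s t} _ := idIf F (s ∈ J) (t ∈ J)
  map_self t := idIf_self (t ∈ J)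
  map_comp h h' := idIf_comp fun hr ht => ⟨hr.1.trans h, h'.trans ht.2⟩

/-- `m` lists the multiplicities of an interval decomposition of `V`, i.e. `V` is isomorphic to
the direct sum over all intervals `J` of `m J` copies of `k_J`. -/
def IsIntervalDecomposition (V : PersistenceModule.{u, v} F) (m : NonemptyInterval ℤ → ℕ) : Prop :=
  Nonempty (V.Iso (directSum fun i : (Σ J : NonemptyInterval ℤ, Fin (m J)) => interval F i.1))

/-- `J ∈ Barc(V)`: the interval module `k_J` appears in the interval decomposition of `V`. -/
def IsBar (V : PersistenceModule.{u, v} F) (J : NonemptyInterval ℤ) : Prop :=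
  ∃ m : NonemptyInterval ℤ → ℕ, V.IsIntervalDecomposition m ∧ 0 < m J

/-- The nestedness `Ξ(V)`: the least distance between corresponding endpoints of a pair of strictly
nested bars of `V`, and `∞` if there is no such pair. -/
noncomputable def nestedness (V : PersistenceModule.{u, v} F) : ℕ∞ :=
  ⨅ (I : NonemptyInterval ℤ) (J : NonemptyInterval ℤ) (_ : V.IsBar I) (_ : V.IsBar J)
    (_ : StrictlyNested I J),
    ((min (I.fst - J.fst).natAbs (I.snd - J.snd).natAbs : ℕ) : ℕ∞)

/-! ## Interleavings -/

/-- `(Φ, Ψ)` is a `δ`-interleaving: `Ψ_{t+δ} ∘ Φ_t = v_{t,t+2δ}` and `Φ_{t+δ} ∘ Ψ_t = w_{t,t+2δ}`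
for all `t`. -/
def IsInterleaving {V : PersistenceModule.{u, v} F} {W : PersistenceModule.{u, w} F} (δ : ℕ)
    (Φ : V.Hom (W.shift δ)) (Ψ : W.Hom (V.shift δ)) : Prop :=
  (∀ (t : ℤ) (h : t ≤ t + δ + δ) (x : V.obj t), Ψ.app (t + δ) (Φ.app t x) = V.map h x) ∧
  (∀ (t : ℤ) (h : t ≤ t + δ + δ) (y : W.obj t), Φ.app (t + δ) (Ψ.app t y) = W.map h y)

end PersistenceModule

/-! ## Ladder persistence modules -/

/-- A ladder persistence module `(V, W, Φ)`. -/
structure LadderModule (F : Type u) [Field F] where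
  source : PersistenceModule.{u, v} F
  target : PersistenceModule.{u, w} F
  hom : source.Hom target

namespace LadderModule

open PersistenceModule

variable {F : Type u} [Field F]

/-- Isomorphisms of ladder persistence modules: isomorphisms of the sources and of the targets
that form commutative squares with the morphisms. -/
structure Iso (L : LadderModule.{u, v, w} F) (L' : LadderModule.{u, v', w'} F) where
  source : L.source.Iso L'.source
  target : L.target.Iso L'.target
  comm : ∀ (t : ℤ) (x : L.source.obj t),
    target.app t (L.hom.app t x) = L'.hom.app t (source.app t x)

/-- Direct sum of a family of ladder persistence modules. -/
noncomputable def directSum {ι : Type} (L : ι → LadderModule.{u, v, w} F) :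
    LadderModule.{u, v, w} F where
  source := PersistenceModule.directSum fun i => (L i).source
  target := PersistenceModule.directSum fun i => (L i).target
  hom :=
    { app := fun t => DirectSum.lmap fun i => (L i).hom.app t
      naturality := fun h => by
        refine (DirectSum.lmap_comp _ _).symm.trans (Eq.trans ?_ (DirectSum.lmap_comp _ _))
        exact congrArg DirectSum.lmap (funext fun i => (L i).hom.naturality h) }

/-- The labels of the elementary ladder persistence modules. -/
inductive ElementaryType where
  /-- `R_K^J`, with the interval `J` on the source side and `K ⪯ J` on the target side -/
  | R (K J : NonemptyInterval ℤ) (h : Overlap K J)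
  /-- `I⁺_J` -/
  | IPlus (J : NonemptyInterval ℤ)
  /-- `I⁻_K` -/
  | IMinus (K : NonemptyInterval ℤ)

/-- The elementary ladder persistence modules: `R_K^J` is `k_J → k_K`, given by the identity at
each index in `J ∩ K` and zero elsewhere; `I⁺_J` is `k_J → 0`; `I⁻_K` is `0 → k_K`. -/
noncomputable def elementary (F : Type u) [Field F] : ElementaryType → LadderModule.{u, u, u} F
  | .R K J h =>
    { source := interval F J
      target := interval F K
      hom :=
        { app := fun t => idIf F (t ∈ J) (t ∈ K)
          naturality := fun {s t} hst => idIf_comp_eq fun hs ht =>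
            ⟨fun _ => ⟨h.1.trans hs.1, hst.trans ht.2⟩,
              fun _ => ⟨hs.1.trans hst, ht.2.trans h.2.2⟩⟩ } }
  | .IPlus J =>
    { source := interval F J
      target := zero F
      hom := { app := fun _ => 0, naturality := fun _ => by simp } }
  | .IMinus K =>
    { source := zero F
      target := interval F K
      hom := { app := fun _ => 0, naturality := fun _ => by simp } }

/-- `m` lists the multiplicities of a ladder decomposition of `L`, i.e. `L` is isomorphic to the
direct sum, over all elementary ladder modules, of `m e` copies of the elementary module `e`. -/
def IsLadderDecomposition (L : LadderModule.{u, v, w} F) (m : ElementaryType → ℕ) : Prop :=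
  Nonempty (L.Iso (directSum fun i : (Σ e : ElementaryType, Fin (m e)) => elementary F i.1))

open Classical in
/-- The multiplicity of `R_K^J` in a decomposition with multiplicities `m` (zero unless `K ⪯ J`,
as `R_K^J` exists only in that case). -/
noncomputable def multR (m : ElementaryType → ℕ) (K J : NonemptyInterval ℤ) : ℕ :=
  if h : Overlap K J then m (.R K J h) else 0

end LadderModule

namespace PersistenceModule

variable {F : Type u} [Field F]

/-! Summands are detected by elements and functionals. An element of V_c that dies right after d and
whose image in V_d comes from no index before c (`HasBar`), with a functional on V_d that is 1 on
this image and kills everything older than c, makes k_[c,d] a retract. Two elements and two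
functionals compatible with the morphism do the same for R_K^J (`nonempty_retract_R`).

Existence. Put e = 2δ. As ΨΦ and ΦΨ are shifts by e, the kernel and cokernel of Φ are annihilated by
shifts by e (`IsInterleaving.almostIso`), while endpoints of strictly nested bars differ by more
than e (`nestedGap_of_lt_nestedness`). Both properties pass to complements of retracts, so by
induction on dimension it suffices to find one elementary retract.
`exists_retract_of_source_ne_zero` takes a source element x with the earliest death d and, for this
d, the earliest birth c. If Φx = 0, it spans I⁺. Otherwise the birth a and death b of Φx give
R_[a,b]^[c,d], provided that Φx at b is not a sum of something older than a and the image of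
something older than c. `NestedGap.map_eq_zero` and `NestedGap.exists_older` ensure this: old
elements can be replaced by ones e older, which lift along Φ far enough to be shown zero.

Multiplicities. Copies of R_[a-δ,b-δ]^[c,d] in Φ give x_p in V_c, y_p in W_a and functionals g_p on
V_d, k_p on W_b. The interleaving makes Ψy_p agree with x_p from c+2δ on and makes g_pΨ equal k_p on
W_a; the lengths of the bars keep the indices involved inside them. The gap shows that Ψy_p comes
from V_c, although perhaps not from x_p. The counting criterion `IsLadderDecomposition.le_mult`
tolerates this and bounds the multiplicity for Ψ from below; exchanging the roles gives equality. -/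

theorem map_map (V : PersistenceModule.{u, v} F) {r s t : ℤ} (h : r ≤ s) (h' : s ≤ t)
    (x : V.obj r) : V.map h' (V.map h x) = V.map (h.trans h') x :=
  LinearMap.congr_fun (V.map_comp h h') x

theorem map_rfl (V : PersistenceModule.{u, v} F) {t : ℤ} (h : t ≤ t) (x : V.obj t) :
    V.map h x = x :=
  LinearMap.congr_fun (V.map_self t) x

theorem Hom.app_map {V : PersistenceModule.{u, v} F} {W : PersistenceModule.{u, w} F}
    (f : V.Hom W) {s t : ℤ} (h : s ≤ t) (x : V.obj s) :
    f.app t (V.map h x) = W.map h (f.app s x) :=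
  LinearMap.congr_fun (f.naturality h) x

/-! ### Births, deaths and bars -/

/-- An element of `V_c` generates a direct summand `k_{[c, d]}` of `V`. -/
def HasBar (V : PersistenceModule.{u, v} F) (c d : ℤ) : Prop :=
  ∃ (h : c ≤ d) (x : V.obj c), (∀ t (ht : c ≤ t), d < t → V.map ht x = 0) ∧
    ∀ s (hs : s < c) (y : V.obj s), V.map (hs.le.trans h) y ≠ V.map h x

/-- Below the support every preimage is zero, so the indices from which a nonzero `x` is reached are
bounded below and have a least element. -/
theorem IsFinite.exists_birth {V : PersistenceModule.{u, v} F} (hV : V.IsFinite) {t : ℤ}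
    {x : V.obj t} (hx : x ≠ 0) :
    ∃ (c : ℤ) (h : c ≤ t) (k : V.obj c), V.map h k = x ∧
      ∀ r (hr : r < c) (y : V.obj r), V.map (hr.le.trans h) y ≠ x := by
  obtain ⟨a, b, hab⟩ := hV.bounded
  obtain ⟨c, ⟨h, k, hk⟩, hc⟩ := Int.exists_least_of_bdd
    (P := fun c => ∃ (h : c ≤ t) (k : V.obj c), V.map h k = x)
    ⟨a, fun z ⟨h, k, hk⟩ => by
      by_contra! hz
      have := hab z (Or.inl hz)
      rw [Subsingleton.elim k 0, map_zero] at hk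
      exact hx hk.symm⟩ ⟨t, le_rfl, x, V.map_rfl _ x⟩
  exact ⟨c, h, k, hk, fun r hr y hy => (hc r ⟨hr.le.trans h, y, hy⟩).not_gt hr⟩

theorem IsFinite.exists_death {V : PersistenceModule.{u, v} F} (hV : V.IsFinite) {c : ℤ}
    {x : V.obj c} (hx : x ≠ 0) :
    ∃ (d : ℤ) (h : c ≤ d), V.map h x ≠ 0 ∧ ∀ t (ht : c ≤ t), d < t → V.map ht x = 0 := by
  obtain ⟨a, b, hab⟩ := hV.bounded
  obtain ⟨d, ⟨h, hd⟩, hmax⟩ := Int.exists_greatest_of_bdd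
    (P := fun d => ∃ h : c ≤ d, V.map h x ≠ 0)
    ⟨b, fun z ⟨h, hz⟩ => by
      by_contra! hbz
      have := hab z (Or.inr hbz)
      exact hz (Subsingleton.elim _ _)⟩ ⟨c, le_rfl, by rwa [V.map_rfl]⟩
  refine ⟨d, h, hd, fun t ht hdt => ?_⟩
  by_contra hne
  exact (hmax t ⟨ht, hne⟩).not_gt hdt

/-- An element born at `c`, which becomes equal to an older element after `s` and not later than
at `t`, gives rise to a bar starting at `c` and ending in `[s, t)`. -/
theorem exists_hasBar {V : PersistenceModule.{u, v} F} {c s t r : ℤ} (hcs : c ≤ s) (hst : s ≤ t)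
    (k : V.obj c) (hs : ∀ r (hr : r < c) (y : V.obj r), V.map (hr.le.trans hcs) y ≠ V.map hcs k)
    (hr : r < c) (y : V.obj r)
    (ht : V.map ((hr.le.trans hcs).trans hst) y = V.map (hcs.trans hst) k) :
    ∃ d, s ≤ d ∧ d < t ∧ V.HasBar c d := by
  -- The bar ends at the last index where `k` is not yet equal to an older element; the equality
  -- with `y` at `t` persists, so `t` is a bound.
  obtain ⟨d, ⟨h, hd⟩, hmax⟩ := Int.exists_greatest_of_bdd
    (P := fun d => ∃ h : c ≤ d, ∀ r (hr : r < c) (y : V.obj r),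
      V.map (hr.le.trans h) y ≠ V.map h k)
    ⟨t, fun z ⟨h, hz⟩ => by
      by_contra! htz
      refine hz r hr y ?_
      rw [← V.map_map ((hr.le.trans hcs).trans hst) htz.le, ht, V.map_map]⟩ ⟨s, hcs, hs⟩
  have hsd : s ≤ d := hmax s ⟨hcs, hs⟩
  have hdt : d < t := by
    by_contra! htd
    refine hd r hr y ?_
    rw [← V.map_map ((hr.le.trans hcs).trans hst) htd, ht, V.map_map]
  refine ⟨d, hsd, hdt, h, ?_⟩
  have hd1 : ¬∃ h : c ≤ d + 1, ∀ r (hr : r < c) (y : V.obj r),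
      V.map (hr.le.trans h) y ≠ V.map h k := fun H => by
    have := hmax _ H
    omega
  push Not at hd1
  obtain ⟨r', hr', y', hy'⟩ := hd1 (by omega)
  -- Subtracting the older element met at `d + 1` makes the generator die there. It stays new at
  -- `d`: an older expression `z` for the difference would make `k` equal to `z + y'`, formed at the
  -- later of `q` and `r'`.
  refine ⟨k - V.map hr'.le y', fun u hu hdu => ?_, fun q hq z hz => ?_⟩
  · rw [← V.map_map (s := d + 1) (by omega) (by omega), map_sub, V.map_map, hy', sub_self, map_zero]
  · rw [map_sub, V.map_map, eq_sub_iff_add_eq] at hz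
    rcases le_total q r' with hqr | hqr
    · refine hd r' hr' (V.map hqr z + y') ?_
      rw [map_add, V.map_map, hz]
    · refine hd q hq (z + V.map hqr y') ?_
      rw [map_add, V.map_map, hz]

/-- The endpoints of strictly nested bars differ by more than `e`. -/
def NestedGap (V : PersistenceModule.{u, v} F) (e : ℤ) : Prop :=
  ∀ a b c d : ℤ, V.HasBar a b → V.HasBar c d → c < a → b < d → e < a - c ∧ e < d - b

/-! ### Splitting off a retract -/

/-- The section preserves death and the retraction carries older preimages back. Hence gap
conditions pass to summands. -/
theorem HasBar.of_retract {V : PersistenceModule.{u, v} F} {W : PersistenceModule.{u, w} F}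
    {c d : ℤ} (hW : W.HasBar c d) (i : W.Hom V) (p : V.Hom W)
    (hpi : ∀ t x, p.app t (i.app t x) = x) : V.HasBar c d := by
  obtain ⟨h, x, hx, hx'⟩ := hW
  refine ⟨h, i.app c x, fun t ht hdt => ?_, fun s hs y hy => hx' s hs (p.app s y) ?_⟩
  · rw [← i.app_map, hx t ht hdt, map_zero]
  · rw [← p.app_map, hy, p.app_map, hpi]

/-- The kernel of a morphism. -/
def kernel {V : PersistenceModule.{u, v} F} {W : PersistenceModule.{u, w} F} (p : V.Hom W) :
    PersistenceModule.{u, v} F where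
  obj t := LinearMap.ker (p.app t)
  map h := (V.map h).restrict fun x hx => by
    rw [LinearMap.mem_ker] at hx ⊢
    rw [p.app_map, hx, map_zero]
  map_self t := by
    ext x
    exact V.map_rfl _ _
  map_comp h h' := by
    ext x
    exact V.map_map _ _ _

/-- The inclusion of the kernel of a morphism. -/
def kernelIncl {V : PersistenceModule.{u, v} F} {W : PersistenceModule.{u, w} F} (p : V.Hom W) :
    (kernel p).Hom V where
  app t := (LinearMap.ker (p.app t)).subtype
  naturality _ := rfl

theorem app_kernelIncl {V : PersistenceModule.{u, v} F} {W : PersistenceModule.{u, w} F}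
    (p : V.Hom W) (t : ℤ) (x : (kernel p).obj t) : p.app t ((kernelIncl p).app t x) = 0 :=
  LinearMap.mem_ker.1 (Subtype.prop x)

theorem kernelIncl_injective {V : PersistenceModule.{u, v} F} {W : PersistenceModule.{u, w} F}
    (p : V.Hom W) (t : ℤ) : Function.Injective ((kernelIncl p).app t) :=
  Subtype.val_injective

/-- The map `x ↦ x - i (p x)` to the kernel of a retraction `p` with section `i`. -/
def kernelProjApp {V : PersistenceModule.{u, v} F} {W : PersistenceModule.{u, w} F}
    (i : W.Hom V) (p : V.Hom W) (hpi : ∀ t x, p.app t (i.app t x) = x) (t : ℤ) :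
    V.obj t →ₗ[F] (kernel p).obj t :=
  (LinearMap.id - i.app t ∘ₗ p.app t).codRestrict (LinearMap.ker (p.app t))
    fun x => by simp [hpi]

/-- The projection `x ↦ x - i (p x)` onto the kernel of a retraction `p` with section `i`. -/
def kernelProj {V : PersistenceModule.{u, v} F} {W : PersistenceModule.{u, w} F} (i : W.Hom V)
    (p : V.Hom W) (hpi : ∀ t x, p.app t (i.app t x) = x) : V.Hom (kernel p) where
  app := kernelProjApp i p hpi
  naturality {s t} h := by
    refine LinearMap.ext fun x => kernelIncl_injective p t ?_
    change V.map h x - i.app t (p.app t (V.map h x)) = V.map h (x - i.app s (p.app s x))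
    rw [p.app_map, i.app_map, map_sub]

theorem kernelIncl_kernelProj {V : PersistenceModule.{u, v} F} {W : PersistenceModule.{u, w} F}
    (i : W.Hom V) (p : V.Hom W) (hpi : ∀ t x, p.app t (i.app t x) = x) (t : ℤ) (x : V.obj t) :
    (kernelIncl p).app t ((kernelProj i p hpi).app t x) = x - i.app t (p.app t x) :=
  rfl

theorem kernelProj_kernelIncl {V : PersistenceModule.{u, v} F} {W : PersistenceModule.{u, w} F}
    (i : W.Hom V) (p : V.Hom W) (hpi : ∀ t x, p.app t (i.app t x) = x) (t : ℤ)
    (x : (kernel p).obj t) : (kernelProj i p hpi).app t ((kernelIncl p).app t x) = x := by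
  apply kernelIncl_injective
  rw [kernelIncl_kernelProj, app_kernelIncl, map_zero, sub_zero]

theorem IsFinite.kernel {V : PersistenceModule.{u, v} F} (hV : V.IsFinite)
    {W : PersistenceModule.{u, w} F} (p : V.Hom W) : (kernel p).IsFinite where
  finiteDimensional t := by
    have := hV.finiteDimensional t
    exact FiniteDimensional.finiteDimensional_submodule (LinearMap.ker (p.app t))
  bounded := by
    obtain ⟨a, b, hab⟩ := hV.bounded
    refine ⟨a, b, fun t ht => ?_⟩
    have := hab t ht
    exact inferInstanceAs (Subsingleton (LinearMap.ker (p.app t)))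

theorem NestedGap.kernel {V : PersistenceModule.{u, v} F} {e : ℤ} (hV : V.NestedGap e)
    {W : PersistenceModule.{u, w} F} (i : W.Hom V) (p : V.Hom W)
    (hpi : ∀ t x, p.app t (i.app t x) = x) : (PersistenceModule.kernel p).NestedGap e := by
  have key : ∀ a b, (PersistenceModule.kernel p).HasBar a b → V.HasBar a b := fun a b h =>
    h.of_retract (kernelIncl p) (kernelProj i p hpi)
      (kernelProj_kernelIncl i p hpi)
  exact fun a b c d h h' => hV a b c d (key _ _ h) (key _ _ h')

theorem finrank_kernel_le {V : PersistenceModule.{u, v} F} (hV : V.IsFinite)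
    {W : PersistenceModule.{u, w} F} (p : V.Hom W) (t : ℤ) :
    Module.finrank F ((PersistenceModule.kernel p).obj t) ≤ Module.finrank F (V.obj t) :=
  have := hV.finiteDimensional t
  Submodule.finrank_le _

theorem finrank_kernel_lt {V : PersistenceModule.{u, v} F} (hV : V.IsFinite)
    {W : PersistenceModule.{u, w} F} (i : W.Hom V) (p : V.Hom W)
    (hpi : ∀ t x, p.app t (i.app t x) = x) {t : ℤ} {x : W.obj t} (hx : x ≠ 0) :
    Module.finrank F ((PersistenceModule.kernel p).obj t) < Module.finrank F (V.obj t) := by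
  have := hV.finiteDimensional t
  refine Submodule.finrank_lt fun h => hx ?_
  rw [← hpi t x]
  exact LinearMap.mem_ker.1 (h ▸ Submodule.mem_top)

/-- The splitting `V_t ≅ W_t × (ker p)_t` defined by a retraction `p` with section `i`. -/
def retractEquiv {V : PersistenceModule.{u, v} F} {W : PersistenceModule.{u, w} F}
    (i : W.Hom V) (p : V.Hom W) (hpi : ∀ t x, p.app t (i.app t x) = x) (t : ℤ) :
    V.obj t ≃ₗ[F] W.obj t × (kernel p).obj t where
  toFun x := (p.app t x, (kernelProj i p hpi).app t x)
  invFun y := i.app t y.1 + (kernelIncl p).app t y.2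
  map_add' x y := by simp
  map_smul' c x := by simp
  left_inv x := by
    dsimp only
    rw [kernelIncl_kernelProj, add_sub_cancel]
  right_inv y := by
    have h1 : p.app t (i.app t y.1 + (kernelIncl p).app t y.2) = y.1 := by
      rw [map_add, hpi, app_kernelIncl, add_zero]
    refine Prod.ext h1 (kernelIncl_injective p t ?_)
    dsimp only
    rw [kernelIncl_kernelProj, h1, add_sub_cancel_left]

/-! ### Direct sums -/

/-- The projection of a direct sum to a summand. -/
def component {ι : Type} (M : ι → PersistenceModule.{u, w} F) (i : ι) :
    (directSum M).Hom (M i) where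
  app t := DirectSum.component F ι (fun i => (M i).obj t) i
  naturality _ := rfl

theorem directSum_ext {ι : Type} {M : ι → PersistenceModule.{u, w} F} {t : ℤ}
    {x y : (directSum M).obj t} (h : ∀ i, (component M i).app t x = (component M i).app t y) :
    x = y :=
  DFinsupp.ext h

/-- The isomorphism `V ≅ W ⊕ ker p` defined by a retraction, as an isomorphism to a direct sum
when `ker p` is one. -/
noncomputable def isoOfRetract {ι : Type} {N : Option ι → PersistenceModule.{u, w} F}
    {V : PersistenceModule.{u, v} F} (i : (N none).Hom V) (p : V.Hom (N none))
    (hpi : ∀ t x, p.app t (i.app t x) = x)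
    (e : (kernel p).Iso (directSum fun j => N (some j))) : V.Iso (directSum N) where
  app t := (retractEquiv i p hpi t).trans (((LinearEquiv.refl F _).prodCongr (e.app t)).trans
    (DirectSum.lequivProdDirectSum (α := fun j => (N j).obj t) F).symm)
  naturality {s t} h x := by
    refine directSum_ext fun j => ?_
    cases j with
    | none => exact p.app_map h x
    | some j =>
      change (component (fun j => N (some j)) j).app t
          (e.app t ((kernelProj i p hpi).app t (V.map h x)))
        = (N (some j)).map h ((component (fun j => N (some j)) j).app s
          (e.app s ((kernelProj i p hpi).app s x)))
      rw [Hom.app_map, e.naturality, Hom.app_map]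

/-- The reindexing `⨁ᵢ M_{h i} ≅ ⨁ₖ M_k` at an index. -/
noncomputable def reindexEquiv {ι κ : Type} (h : ι ≃ κ) (M : κ → PersistenceModule.{u, w} F)
    (t : ℤ) : (directSum fun i => M (h i)).obj t ≃ₗ[F] (directSum M).obj t :=
  (DirectSum.lequivCongrLeft F (M := fun k => (M k).obj t) h.symm).symm

theorem component_reindexEquiv {ι κ : Type} (h : ι ≃ κ) (M : κ → PersistenceModule.{u, w} F)
    (t : ℤ) (x : (directSum fun i => M (h i)).obj t) (i : ι) :
    (component M (h i)).app t (reindexEquiv h M t x) =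
      (component (fun i => M (h i)) i).app t x := by
  obtain ⟨y, rfl⟩ := (reindexEquiv h M t).symm.surjective x
  rw [LinearEquiv.apply_symm_apply]
  exact (DirectSum.lequivCongrLeft_apply F h.symm _ i).symm

/-- Reindexing of a direct sum decomposition. -/
noncomputable def Iso.reindex {ι κ : Type} {V : PersistenceModule.{u, v} F} (h : ι ≃ κ)
    (M : κ → PersistenceModule.{u, w} F) (e : V.Iso (directSum fun i => M (h i))) :
    V.Iso (directSum M) where
  app t := (e.app t).trans (reindexEquiv h M t)
  naturality {s t} hst x := by
    refine directSum_ext fun k => ?_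
    obtain ⟨i, rfl⟩ := h.surjective k
    rw [Hom.app_map, LinearEquiv.trans_apply, LinearEquiv.trans_apply, component_reindexEquiv,
      component_reindexEquiv, e.naturality, Hom.app_map]

theorem component_reindex {ι κ : Type} {V : PersistenceModule.{u, v} F} (h : ι ≃ κ)
    (M : κ → PersistenceModule.{u, w} F) (e : V.Iso (directSum fun i => M (h i))) (t : ℤ)
    (x : V.obj t) (i : ι) : (component M (h i)).app t ((e.reindex h M).app t x) =
      (component (fun i => M (h i)) i).app t (e.app t x) :=
  component_reindexEquiv h M t _ i

/-! ### Interval modules as retracts -/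

/-- The embedding of `(k_J)_t` into the field. -/
noncomputable def intervalVal (F : Type u) [Field F] (J : NonemptyInterval ℤ) (t : ℤ) :
    (interval F J).obj t →ₗ[F] F :=
  (fieldIf F (t ∈ J)).subtype

theorem intervalVal_injective (J : NonemptyInterval ℤ) (t : ℤ) :
    Function.Injective (intervalVal F J t) :=
  Subtype.val_injective

theorem interval_eq_zero {J : NonemptyInterval ℤ} {t : ℤ} (ht : t ∉ J)
    (x : (interval F J).obj t) : x = 0 :=
  fieldIf_eq_zero ht x

theorem intervalVal_map {J : NonemptyInterval ℤ} {s t : ℤ} (h : s ≤ t) (ht : t ∈ J)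
    (x : (interval F J).obj s) :
    intervalVal F J t ((interval F J).map h x) = intervalVal F J s x :=
  if_pos ht

/-- The generator of `(k_J)_t`. -/
noncomputable def intervalGen (F : Type u) [Field F] {J : NonemptyInterval ℤ} {t : ℤ}
    (ht : t ∈ J) : (interval F J).obj t :=
  (⟨1, by rw [fieldIf, if_pos ht]; exact Submodule.mem_top⟩ : fieldIf F (t ∈ J))

theorem intervalVal_intervalGen {J : NonemptyInterval ℤ} {t : ℤ} (ht : t ∈ J) :
    intervalVal F J t (intervalGen F ht) = 1 :=
  rfl

theorem intervalGen_ne_zero {J : NonemptyInterval ℤ} {t : ℤ} (ht : t ∈ J) :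
    intervalGen F ht ≠ 0 := fun h0 => by
  have := intervalVal_intervalGen (F := F) ht
  rw [h0, map_zero] at this
  exact zero_ne_one this

theorem fst_mem (J : NonemptyInterval ℤ) : J.fst ∈ J := ⟨le_rfl, J.fst_le_snd⟩

theorem snd_mem (J : NonemptyInterval ℤ) : J.snd ∈ J := ⟨J.fst_le_snd, le_rfl⟩

open Classical in
/-- The morphism from `k_J` determined by an element at the left endpoint of `J`. -/
noncomputable def fromInterval (V : PersistenceModule.{u, v} F) (J : NonemptyInterval ℤ)
    (x : V.obj J.fst) (hx : ∀ t (ht : J.fst ≤ t), J.snd < t → V.map ht x = 0) :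
    (interval F J).Hom V where
  app t := if h : J.fst ≤ t then
    (LinearMap.toSpanSingleton F (V.obj t) (V.map h x)) ∘ₗ intervalVal F J t else 0
  naturality {s t} h := by
    refine LinearMap.ext fun r => ?_
    by_cases hs : J.fst ≤ s
    · have ht := hs.trans h
      rw [dif_pos hs, dif_pos ht]
      change intervalVal F J t ((interval F J).map h r) • V.map ht x
        = V.map h (intervalVal F J s r • V.map hs x)
      rw [map_smul, V.map_map]
      by_cases htJ : t ∈ J
      · rw [intervalVal_map h htJ]
      · have : J.snd < t := by
          by_contra! hle
          exact htJ ⟨ht, hle⟩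
        rw [hx t ht this, smul_zero, smul_zero]
    · rw [interval_eq_zero (fun hsJ => hs hsJ.1) r, map_zero, map_zero]

theorem fromInterval_app {V : PersistenceModule.{u, v} F} {J : NonemptyInterval ℤ}
    {x : V.obj J.fst} {hx : ∀ t (ht : J.fst ≤ t), J.snd < t → V.map ht x = 0}
    {t : ℤ} (h : J.fst ≤ t) (r : (interval F J).obj t) :
    (V.fromInterval J x hx).app t r = intervalVal F J t r • V.map h x := by
  simp only [fromInterval, dif_pos h]
  rfl

open Classical in
/-- The map to `(k_J)_t` determined by a functional at the right endpoint of `J`. -/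
noncomputable def toIntervalApp (V : PersistenceModule.{u, v} F) (J : NonemptyInterval ℤ)
    (g : V.obj J.snd →ₗ[F] F) (t : ℤ) : V.obj t →ₗ[F] (interval F J).obj t :=
  LinearMap.codRestrict (fieldIf F (t ∈ J)) (if h : t ∈ J then g ∘ₗ V.map h.2 else 0) fun x => by
    by_cases h : t ∈ J
    · rw [fieldIf, if_pos h]
      exact Submodule.mem_top
    · rw [dif_neg h]
      exact Submodule.zero_mem _

theorem intervalVal_toIntervalApp {V : PersistenceModule.{u, v} F} {J : NonemptyInterval ℤ}
    (g : V.obj J.snd →ₗ[F] F) {t : ℤ} (h : t ∈ J) (x : V.obj t) :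
    intervalVal F J t (toIntervalApp V J g t x) = g (V.map h.2 x) :=
  LinearMap.congr_fun (dif_pos (α := V.obj t →ₗ[F] F) h) x

/-- The morphism to `k_J` determined by a functional at the right endpoint of `J`. -/
noncomputable def toInterval (V : PersistenceModule.{u, v} F) (J : NonemptyInterval ℤ)
    (g : V.obj J.snd →ₗ[F] F)
    (hg : ∀ s (hs : s < J.fst) (y : V.obj s), g (V.map (hs.le.trans J.fst_le_snd) y) = 0) :
    V.Hom (interval F J) where
  app := toIntervalApp V J g
  naturality {s t} hst := by
    refine LinearMap.ext fun x => ?_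
    change toIntervalApp V J g t (V.map hst x) = (interval F J).map hst (toIntervalApp V J g s x)
    by_cases ht : t ∈ J
    · apply intervalVal_injective
      rw [intervalVal_map hst ht, intervalVal_toIntervalApp g ht, V.map_map]
      by_cases hs : s ∈ J
      · rw [intervalVal_toIntervalApp g hs]
      · have hs' : s < J.fst := by
          by_contra! hle
          exact hs ⟨hle, hst.trans ht.2⟩
        rw [interval_eq_zero hs (toIntervalApp V J g s x), map_zero, hg s hs']
    · rw [interval_eq_zero ht (toIntervalApp V J g t _),
        interval_eq_zero ht ((interval F J).map hst _)]

theorem intervalVal_toInterval {V : PersistenceModule.{u, v} F} {J : NonemptyInterval ℤ}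
    {g : V.obj J.snd →ₗ[F] F}
    {hg : ∀ s (hs : s < J.fst) (y : V.obj s), g (V.map (hs.le.trans J.fst_le_snd) y) = 0}
    {t : ℤ} (h : t ∈ J) (x : V.obj t) :
    intervalVal F J t ((V.toInterval J g hg).app t x) = g (V.map h.2 x) :=
  intervalVal_toIntervalApp g h x

theorem toInterval_fromInterval {V : PersistenceModule.{u, v} F} {J : NonemptyInterval ℤ}
    {x : V.obj J.fst} {hx : ∀ t (ht : J.fst ≤ t), J.snd < t → V.map ht x = 0}
    {g : V.obj J.snd →ₗ[F] F}
    {hg : ∀ s (hs : s < J.fst) (y : V.obj s), g (V.map (hs.le.trans J.fst_le_snd) y) = 0}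
    (hgx : g (V.map J.fst_le_snd x) = 1) (t : ℤ) (r : (interval F J).obj t) :
    (V.toInterval J g hg).app t ((V.fromInterval J x hx).app t r) = r := by
  by_cases ht : t ∈ J
  · apply intervalVal_injective
    rw [intervalVal_toInterval ht, fromInterval_app ht.1, map_smul, V.map_map, map_smul, hgx,
      smul_eq_mul, mul_one]
  · rw [interval_eq_zero ht r, map_zero, map_zero]

theorem exists_dual_eq_one_of_notMem {E : Type*} [AddCommGroup E] [Module F E] {S : Submodule F E}
    {x : E} (hx : x ∉ S) : ∃ g : E →ₗ[F] F, (∀ y ∈ S, g y = 0) ∧ g x = 1 := by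
  obtain ⟨f, hf, hS⟩ := Submodule.exists_dual_map_eq_bot_of_notMem (R := F) hx inferInstance
  refine ⟨(f x)⁻¹ • f, fun y hy => ?_, by simp [hf]⟩
  have : f y ∈ Submodule.map f S := ⟨y, hy, rfl⟩
  rw [hS, Submodule.mem_bot] at this
  simp [this]

/-- The functional on `V_d` that exhibits `k_{[c, d]}` as a quotient of `V`. -/
theorem exists_dual_of_birth {V : PersistenceModule.{u, v} F} {c d : ℤ} (h : c ≤ d) (x : V.obj d)
    (hx : ∀ s (hs : s < c) (y : V.obj s), V.map (hs.le.trans h) y ≠ x) :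
    ∃ g : V.obj d →ₗ[F] F,
      (∀ s (hs : s < c) (y : V.obj s), g (V.map (hs.le.trans h) y) = 0) ∧ g x = 1 := by
  -- Everything older than `c` lies in the image of the single map from `c - 1`, so one subspace has
  -- to be avoided.
  have h1 : c - 1 ≤ d := by omega
  obtain ⟨g, hg, hgx⟩ := exists_dual_eq_one_of_notMem (S := LinearMap.range (V.map h1)) (x := x)
    (by rintro ⟨y, hy⟩; exact hx (c - 1) (by omega) y hy)
  refine ⟨g, fun s hs y => hg _ ⟨V.map (show s ≤ c - 1 by omega) y, V.map_map _ _ y⟩, hgx⟩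

/-- A bar exhibits the corresponding interval module as a retract. -/
theorem HasBar.exists_retract {V : PersistenceModule.{u, v} F} {J : NonemptyInterval ℤ}
    (hJ : V.HasBar J.fst J.snd) :
    ∃ (i : (interval F J).Hom V) (p : V.Hom (interval F J)), ∀ t x, p.app t (i.app t x) = x := by
  obtain ⟨h, x, hx, hx'⟩ := hJ
  obtain ⟨g, hg, hgx⟩ := exists_dual_of_birth h _ hx'
  exact ⟨V.fromInterval J x hx, V.toInterval J g hg, toInterval_fromInterval hgx⟩

/-! ### Interval decompositions -/

/-- The span from birth to death need not be a bar, since the element may merge with an older one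
before it dies. Taking 0 at `c - 1` as the older element, `exists_hasBar` finds a genuine right
endpoint. -/
theorem exists_hasBar_of_ne_zero {V : PersistenceModule.{u, v} F} (hV : V.IsFinite) {t : ℤ}
    {x : V.obj t} (hx : x ≠ 0) : ∃ c d, V.HasBar c d := by
  obtain ⟨c, hc, k, hk, hk'⟩ := hV.exists_birth hx
  obtain ⟨d, hd, -, hd'⟩ := hV.exists_death hx
  have h1 : t ≤ d + 1 := by omega
  obtain ⟨e, -, -, he⟩ := exists_hasBar (r := c - 1) hc h1 k (fun r hr y => hk ▸ hk' r hr y)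
    (by omega) 0 (by rw [map_zero, ← V.map_map hc h1, hk, hd' _ h1 (by omega)])
  exact ⟨c, e, he⟩

/-- An isomorphism between persistence modules that vanish at all indices. -/
def isoOfSubsingleton {V : PersistenceModule.{u, v} F} {W : PersistenceModule.{u, w} F}
    (hV : ∀ t, Subsingleton (V.obj t)) (hW : ∀ t, Subsingleton (W.obj t)) : V.Iso W where
  app t :=
    { toFun := fun _ => 0
      invFun := fun _ => 0
      map_add' := fun _ _ => (add_zero _).symm
      map_smul' := fun _ _ => (smul_zero _).symm
      left_inv := fun _ => (hV t).elim _ _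
      right_inv := fun _ => (hW t).elim _ _ }
  naturality _ _ := (hW _).elim _ _

theorem subsingleton_directSum_obj {ι : Type} [IsEmpty ι] (M : ι → PersistenceModule.{u, v} F)
    (t : ℤ) : Subsingleton ((directSum M).obj t) :=
  inferInstanceAs (Subsingleton (⨁ i, (M i).obj t))

/-- Induction on the total dimension over a window containing the support: a nonzero module has a
bar, and the kernel of the resulting retraction is smaller. -/
theorem exists_iso_directSum_interval_aux (a b : ℤ) (n : ℕ) (V : PersistenceModule.{u, v} F)
    (hV : V.IsFinite) (hab : ∀ t, t < a ∨ b < t → Subsingleton (V.obj t))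
    (hn : ∑ t ∈ Finset.Icc a b, Module.finrank F (V.obj t) ≤ n) :
    ∃ (ι : Type) (_ : Fintype ι) (f : ι → NonemptyInterval ℤ),
      Nonempty (V.Iso (directSum fun i => interval F (f i))) := by
  induction n generalizing V with
  | zero =>
    refine ⟨PEmpty, inferInstance, PEmpty.elim, ⟨isoOfSubsingleton (fun t => ?_)
      (subsingleton_directSum_obj _)⟩⟩
    by_cases ht : t ∈ Finset.Icc a b
    · have := hV.finiteDimensional t
      rw [Nat.le_zero, Finset.sum_eq_zero_iff] at hn
      exact Module.finrank_zero_iff.1 (hn t ht)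
    · exact hab t (by rw [Finset.mem_Icc] at ht; omega)
  | succ n ih =>
    by_cases h0 : ∀ t, Subsingleton (V.obj t)
    · exact ⟨PEmpty, inferInstance, PEmpty.elim, ⟨isoOfSubsingleton h0
        (subsingleton_directSum_obj _)⟩⟩
    push Not at h0
    obtain ⟨t, ht⟩ := h0
    obtain ⟨x, hx⟩ := exists_ne (0 : V.obj t)
    obtain ⟨c, d, hcd⟩ := exists_hasBar_of_ne_zero hV hx
    obtain ⟨i, p, hpi⟩ := HasBar.exists_retract (J := ⟨(c, d), hcd.1⟩) hcd
    have hlt := finrank_kernel_lt hV i p hpi (intervalGen_ne_zero (F := F) (fst_mem ⟨(c, d), hcd.1⟩))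
    obtain ⟨ι, hι, f, ⟨e⟩⟩ := ih (kernel p) (hV.kernel p)
      (fun s hs => by
        have := hab s hs
        exact inferInstanceAs (Subsingleton (LinearMap.ker (p.app s)))) (by
      refine Nat.le_of_lt_succ (lt_of_lt_of_le ?_ hn)
      refine Finset.sum_lt_sum (fun s _ => finrank_kernel_le hV p s) ⟨c, ?_, hlt⟩
      by_contra hc
      have := hab c (by rw [Finset.mem_Icc] at hc; omega)
      rw [Module.finrank_zero_of_subsingleton (M := V.obj c)] at hlt
      exact absurd hlt (Nat.not_lt_zero _))
    exact ⟨Option ι, inferInstance, fun o => o.elim ⟨(c, d), hcd.1⟩ f,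
      ⟨isoOfRetract (N := fun o : Option ι => interval F (o.elim ⟨(c, d), hcd.1⟩ f)) i p hpi e⟩⟩

theorem IsFinite.exists_iso_directSum_interval {V : PersistenceModule.{u, v} F}
    (hV : V.IsFinite) :
    ∃ (ι : Type) (_ : Fintype ι) (f : ι → NonemptyInterval ℤ),
      Nonempty (V.Iso (directSum fun i => interval F (f i))) := by
  obtain ⟨a, b, hab⟩ := hV.bounded
  exact exists_iso_directSum_interval_aux a b _ V hV hab le_rfl

theorem exists_equiv_sigma_fin {ι A : Type} [Fintype ι] (f : ι → A) :
    ∃ (m : A → ℕ) (h : ι ≃ Σ a, Fin (m a)), f = fun i => (h i).1 := by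
  classical
  exact ⟨fun a => Fintype.card {i // f i = a}, (Equiv.sigmaFiberEquiv f).symm.trans
    (Equiv.sigmaCongrRight fun a => Fintype.equivFin _), rfl⟩

/-- `IsBar` asks for one decomposition containing `J`: split off k_J and decompose the complement.
No uniqueness of decompositions is needed to make the nestedness bound available for `HasBar`. -/
theorem HasBar.isBar {V : PersistenceModule.{u, v} F} (hV : V.IsFinite) {J : NonemptyInterval ℤ}
    (hJ : V.HasBar J.fst J.snd) : V.IsBar J := by
  obtain ⟨i, p, hpi⟩ := hJ.exists_retract
  obtain ⟨ι, hι, f, ⟨e⟩⟩ := (hV.kernel p).exists_iso_directSum_interval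
  have E := isoOfRetract (N := fun o : Option ι => interval F (o.elim J f)) i p hpi e
  obtain ⟨m, h, hf⟩ := exists_equiv_sigma_fin fun o : Option ι => o.elim J f
  have hJm : (h none).1 = J := (congrFun hf none).symm
  refine ⟨m, ?_, ?_⟩
  · replace hf : (fun o : Option ι => interval F (o.elim J f)) = fun o => interval F (h o).1 :=
      funext fun o => congrArg (interval F) (congrFun hf o)
    rw [hf] at E
    exact ⟨E.reindex h fun k => interval F k.1⟩
  · rw [← hJm]
    exact (h none).2.pos

end PersistenceModule

namespace PersistenceModule

variable {F : Type u} [Field F]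

/-! ### Consequences of a lower bound for the nestedness -/

/-- An element born before the bar `[c, d]` and dead at most `e` after it is dead right after it. -/
theorem NestedGap.map_eq_zero {V : PersistenceModule.{u, v} F} (hV : V.IsFinite) {e : ℤ}
    (hgap : V.NestedGap e) {c d s t : ℤ} (hcd : V.HasBar c d) (hs : s < c) (hs' : s ≤ d + 1)
    (ht : d + 1 ≤ t) (hte : t ≤ d + 1 + e) (y : V.obj s) (hy : V.map (hs'.trans ht) y = 0) :
    V.map hs' y = 0 := by
  by_contra hne
  obtain ⟨c', hc', k, hk, hmin⟩ := hV.exists_birth hne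
  have hc's : c' ≤ s := by
    by_contra! h
    exact hmin s h y rfl
  -- The bar `[c', d']` has `c' < c` and `d + 1 ≤ d' < t`, so it strictly contains `[c, d]` although
  -- `d' - d ≤ e`.
  obtain ⟨d', hd', hd't, hbar⟩ := exists_hasBar (r := c' - 1) hc' ht k
    (fun r hr z => hk ▸ hmin r hr z) (by omega) 0
    (by rw [map_zero, ← V.map_map hc' ht, hk, V.map_map, hy])
  have := (hgap c d c' d' hcd hbar (by omega) (by omega)).2
  omega

/-- Up to elements that are dead right after the bar `[c, d]`, an element born before that bar was
already born `e` earlier. -/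
theorem NestedGap.exists_older {V : PersistenceModule.{u, v} F} (hV : V.IsFinite) {e : ℤ}
    (hgap : V.NestedGap e) {c d : ℤ} (hcd : V.HasBar c d) (h1 : c - 1 ≤ d + 1)
    (h2 : c - 1 - e ≤ d + 1) (y : V.obj (c - 1)) :
    ∃ z : V.obj (c - 1 - e), V.map h2 z = V.map h1 y := by
  by_cases hy : V.map h1 y = 0
  · exact ⟨0, by rw [map_zero, hy]⟩
  obtain ⟨c', hc', k, hk, hmin⟩ := hV.exists_birth hy
  have hc's : c' ≤ c - 1 := by
    by_contra! h
    exact hmin _ h y rfl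
  rcases le_or_gt c' (c - 1 - e) with hle | hlt
  · exact ⟨V.map hle k, by rw [V.map_map, hk]⟩
  have hk0 : k ≠ 0 := by
    rintro rfl
    exact hy (by rw [← hk, map_zero])
  obtain ⟨T, hT, -, hT'⟩ := hV.exists_death hk0
  have hdT : d + 1 ≤ T + 1 := by
    by_contra! h
    exact hy (by rw [← hk, hT' _ hc' (by omega)])
  -- A birth `c'` with `c - 1 - e < c' ≤ c - 1` yields a bar that outlives `d`, hence strictly
  -- contains `[c, d]`, with `c - c' ≤ e`.
  obtain ⟨d', hd', -, hbar⟩ := exists_hasBar (r := c' - 1) hc' hdT k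
    (fun r hr z => hk ▸ hmin r hr z) (by omega) 0
    (by rw [map_zero, hT' _ _ (by omega)])
  have := (hgap c d c' d' hcd hbar (by omega) (by omega)).1
  omega

end PersistenceModule

namespace LadderModule

open PersistenceModule

variable {F : Type u} [Field F]

/-! ### Elementary retracts of ladder modules -/

/-- The ladder module `M` is a retract of the ladder module `L`. -/
structure Retract (M : LadderModule.{u, v', w'} F) (L : LadderModule.{u, v, w} F) where
  i : M.source.Hom L.source
  i' : M.target.Hom L.target
  p : L.source.Hom M.source
  p' : L.target.Hom M.target
  p_i : ∀ t x, p.app t (i.app t x) = x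
  p'_i' : ∀ t x, p'.app t (i'.app t x) = x
  comm_i : ∀ t x, L.hom.app t (i.app t x) = i'.app t (M.hom.app t x)
  comm_p : ∀ t x, M.hom.app t (p.app t x) = p'.app t (L.hom.app t x)

/-- The morphism `k_J → k_K` underlying `R_K^J`. -/
noncomputable def overlapHom (F : Type u) [Field F] {J K : NonemptyInterval ℤ}
    (h : Overlap K J) : (interval F J).Hom (interval F K) :=
  (elementary F (.R K J h)).hom

theorem intervalVal_overlapHom {J K : NonemptyInterval ℤ} (h : Overlap K J) {t : ℤ}
    (ht : t ∈ K) (r : (interval F J).obj t) :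
    intervalVal F K t ((overlapHom F h).app t r) = intervalVal F J t r :=
  if_pos ht

/-- The data at the endpoints of the bars that exhibit `R_K^J` as a retract. -/
theorem nonempty_retract_R {L : LadderModule.{u, v, w} F} {J K : NonemptyInterval ℤ}
    (h : Overlap K J) (x : L.source.obj J.fst) (y : L.target.obj K.fst)
    (hx : ∀ t (ht : J.fst ≤ t), J.snd < t → L.source.map ht x = 0)
    (hy : ∀ t (ht : K.fst ≤ t), K.snd < t → L.target.map ht y = 0)
    (hxy : L.hom.app J.fst x = L.target.map h.1 y)
    (p : L.source.obj J.snd →ₗ[F] F) (q : L.target.obj K.snd →ₗ[F] F)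
    (hp : ∀ s (hs : s < J.fst) (z : L.source.obj s),
      p (L.source.map (hs.le.trans J.fst_le_snd) z) = 0)
    (hq : ∀ s (hs : s < K.fst) (z : L.target.obj s),
      q (L.target.map (hs.le.trans K.fst_le_snd) z) = 0)
    (hpq : ∀ z : L.source.obj K.snd, q (L.hom.app K.snd z) = p (L.source.map h.2.2 z))
    (hpx : p (L.source.map J.fst_le_snd x) = 1) :
    Nonempty ((elementary F (.R K J h)).Retract L) := by
  have hqy : q (L.target.map K.fst_le_snd y) = 1 := by
    rw [← L.target.map_map h.1 h.2.1, ← hxy, ← L.hom.app_map, hpq, L.source.map_map, hpx]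
  have hi : ∀ t (r : (interval F J).obj t), L.hom.app t ((L.source.fromInterval J x hx).app t r) =
      (L.target.fromInterval K y hy).app t ((overlapHom F h).app t r) := fun t r => by
    by_cases htJ : t ∈ J
    · have hKt : K.fst ≤ t := h.1.trans htJ.1
      rw [fromInterval_app htJ.1, fromInterval_app hKt, map_smul, L.hom.app_map, hxy,
        L.target.map_map]
      by_cases htK : t ∈ K
      · rw [intervalVal_overlapHom h htK]
      · have : K.snd < t := by
          by_contra! hle
          exact htK ⟨hKt, hle⟩
        rw [hy t hKt this, smul_zero, smul_zero]
    · rw [interval_eq_zero htJ r]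
      simp only [map_zero]
  have hp' : ∀ t (z : L.source.obj t), (overlapHom F h).app t
      ((L.source.toInterval J p hp).app t z) =
        (L.target.toInterval K q hq).app t (L.hom.app t z) := fun t z => by
    by_cases htK : t ∈ K
    · apply intervalVal_injective
      rw [intervalVal_overlapHom h htK, intervalVal_toInterval htK, ← L.hom.app_map, hpq,
        L.source.map_map]
      by_cases htJ : t ∈ J
      · rw [intervalVal_toInterval htJ]
      · have : t < J.fst := by
          by_contra! hle
          exact htJ ⟨hle, htK.2.trans h.2.2⟩
        rw [hp t this, interval_eq_zero htJ (Hom.app _ _ _), map_zero]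
    · exact (interval_eq_zero htK _).trans (interval_eq_zero htK _).symm
  exact ⟨⟨L.source.fromInterval J x hx, L.target.fromInterval K y hy, L.source.toInterval J p hp,
    L.target.toInterval K q hq, toInterval_fromInterval hpx, toInterval_fromInterval hqy, hi, hp'⟩⟩

/-- With zero target, compatibility of the retraction is automatic, and that of the section is
`hx0`; any functional detecting the bar works. -/
theorem nonempty_retract_IPlus {L : LadderModule.{u, v, w} F} {J : NonemptyInterval ℤ}
    (x : L.source.obj J.fst)
    (hx : ∀ t (ht : J.fst ≤ t), J.snd < t → L.source.map ht x = 0)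
    (hx' : ∀ s (hs : s < J.fst) (z : L.source.obj s),
      L.source.map (hs.le.trans J.fst_le_snd) z ≠ L.source.map J.fst_le_snd x)
    (hx0 : L.hom.app J.fst x = 0) : Nonempty ((elementary F (.IPlus J)).Retract L) := by
  obtain ⟨p, hp, hpx⟩ := exists_dual_of_birth J.fst_le_snd _ hx'
  have hi : ∀ t (r : (interval F J).obj t),
      L.hom.app t ((L.source.fromInterval J x hx).app t r) = 0 := fun t r => by
    by_cases ht : t ∈ J
    · rw [fromInterval_app ht.1, map_smul, L.hom.app_map, hx0, map_zero, smul_zero]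
    · rw [interval_eq_zero ht r, map_zero, map_zero]
  exact ⟨⟨L.source.fromInterval J x hx, ⟨fun _ => 0, fun _ => by simp⟩,
    L.source.toInterval J p hp, ⟨fun _ => 0, fun _ => by simp⟩, toInterval_fromInterval hpx,
    fun t x => rfl, hi, fun t z => rfl⟩⟩

theorem nonempty_retract_IMinus {L : LadderModule.{u, v, w} F}
    (hL : ∀ t, Subsingleton (L.source.obj t)) {K : NonemptyInterval ℤ}
    (hK : L.target.HasBar K.fst K.snd) : Nonempty ((elementary F (.IMinus K)).Retract L) := by
  obtain ⟨i, p, hpi⟩ := hK.exists_retract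
  refine ⟨⟨⟨fun _ => 0, fun _ => by simp⟩, i, ⟨fun _ => 0, fun _ => by simp⟩, p, fun t x => rfl,
    hpi, fun t r => ?_, fun t z => ?_⟩⟩
  · rw [(hL t).elim (Hom.app _ t r) 0, map_zero]
    exact (map_zero (i.app t)).symm
  · rw [(hL t).elim z 0]
    simp only [map_zero]

/-- The kernel and the cokernel of a ladder module are annihilated by shifts by `e`. -/
structure AlmostIso (L : LadderModule.{u, v, w} F) (e : ℤ) : Prop where
  ker : ∀ {s t : ℤ} (h : s ≤ t), s + e ≤ t → ∀ x : L.source.obj s, L.hom.app s x = 0 →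
    L.source.map h x = 0
  coker : ∀ {s t : ℤ} (h : s ≤ t), s + e ≤ t → ∀ y : L.target.obj s,
    ∃ x : L.source.obj t, L.hom.app t x = L.target.map h y

/-- The earliest death makes all maps into V_d injective, so functionals on earlier V_b extend to
V_d. The earliest birth makes all maps from before `c` to V_{d+1} injective, so identities at `d +
1` can be pulled back (`hA`). -/
theorem exists_retract_of_source_ne_zero {L : LadderModule.{u, v, w} F}
    (hV : L.source.IsFinite) (hW : L.target.IsFinite) {e : ℤ} (he : 0 ≤ e) (hL : L.AlmostIso e)
    (gV : L.source.NestedGap e) (gW : L.target.NestedGap e) {t₀ : ℤ} {x₀ : L.source.obj t₀}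
    (hx₀ : x₀ ≠ 0) : ∃ E : ElementaryType, Nonempty ((elementary F E).Retract L) := by
  obtain ⟨V, W, Φ⟩ := L
  dsimp only at *
  have hsucc : ∀ d : ℤ, d ≤ d + 1 := fun d => by omega
  obtain ⟨A, B, hAB⟩ := hV.bounded
  -- the earliest death
  obtain ⟨d, ⟨xd, hxd, hxd'⟩, hdmin⟩ := Int.exists_least_of_bdd
    (P := fun d => ∃ x : V.obj d, x ≠ 0 ∧ V.map (hsucc d) x = 0)
    ⟨A, fun z ⟨x, hx, _⟩ => by
      by_contra! hz
      have := hAB z (Or.inl hz)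
      exact hx (Subsingleton.elim _ _)⟩ (by
    obtain ⟨d, hd, hne, hd'⟩ := hV.exists_death hx₀
    exact ⟨d, _, hne, by rw [V.map_map, hd' _ _ (by omega)]⟩)
  have hinj : ∀ s (h : s ≤ d) (x : V.obj s), V.map h x = 0 → x = 0 := by
    intro s h x hx
    by_contra hne
    obtain ⟨d', hd', hne', hdies⟩ := hV.exists_death hne
    have hle := hdmin d' ⟨_, hne', by rw [V.map_map, hdies _ _ (by omega)]⟩
    exact hne' (by rw [← V.map_map h hle, hx, map_zero])
  -- the earliest birth among the elements with this death
  obtain ⟨c, ⟨hcd, hcd1, x, hx0, hxdie⟩, hcmin⟩ := Int.exists_least_of_bdd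
    (P := fun c => c ≤ d ∧ ∃ (h : c ≤ d + 1) (x : V.obj c), x ≠ 0 ∧ V.map h x = 0)
    ⟨A, fun z ⟨_, _, x, hx, _⟩ => by
      by_contra! hz
      have := hAB z (Or.inl hz)
      exact hx (Subsingleton.elim _ _)⟩ ⟨d, le_rfl, hsucc d, xd, hxd, hxd'⟩
  have hA : ∀ s (_ : s < c) (h : s ≤ d + 1) (y : V.obj s), V.map h y = 0 → y = 0 := by
    intro s hs h y hy
    by_contra hne
    exact (hcmin s ⟨by omega, h, y, hne, hy⟩).not_gt hs
  have hxdies : ∀ t (ht : c ≤ t), d < t → V.map ht x = 0 := fun t ht hdt => by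
    rw [← V.map_map hcd1 (show d + 1 ≤ t by omega), hxdie, map_zero]
  have hxnew : ∀ s (hs : s < c) (y : V.obj s), V.map (hs.le.trans hcd) y ≠ V.map hcd x := by
    intro s hs y hy
    have hy0 : y = 0 := hA s hs (by omega) y (by
      rw [← V.map_map (hs.le.trans hcd) (hsucc d), hy, V.map_map, hxdie])
    rw [hy0, map_zero] at hy
    exact hx0 (hinj c hcd x hy.symm)
  have hbar : V.HasBar c d := ⟨hcd, x, hxdies, hxnew⟩
  by_cases hΦx : Φ.app c x = 0
  · exact ⟨.IPlus ⟨(c, d), hcd⟩, nonempty_retract_IPlus (L := ⟨V, W, Φ⟩) x hxdies hxnew hΦx⟩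
  obtain ⟨b, hcb, hz, hbdies⟩ := hW.exists_death hΦx
  obtain ⟨a, hac, y, hy, hamin⟩ := hW.exists_birth hΦx
  have hbd : b ≤ d := by
    by_contra! h
    exact hz (by rw [← Φ.app_map, hxdies b hcb h, map_zero])
  have hz1 : W.map (hsucc b) (W.map hcb (Φ.app c x)) = 0 := by
    rw [W.map_map, hbdies _ _ (by omega)]
  -- Lift `η` at `c - 1` to some `x'` along `Φ`. As `Φ x'` dies by `b + 1`, `x'` dies by `b + 1 + e
  -- ≤ d + 1 + e`; the gap improves this to `d + 1`, and then `hA` gives `x' = 0`.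
  have hD : ∀ m (hm : m + e ≤ c - 1) (η : W.obj m)
      (hη : W.map (show m ≤ b + 1 by omega) η = 0), W.map (show m ≤ c - 1 by omega) η = 0 := by
    intro m hm η hη
    obtain ⟨x', hx'⟩ := hL.coker (show m ≤ c - 1 by omega) hm η
    dsimp only at x' hx'
    have h1 : c - 1 ≤ b + 1 := by omega
    have h2 : b + 1 ≤ d + 1 + e := by omega
    have h3 : V.map h2 (V.map h1 x') = 0 := hL.ker h2 (by omega) _ (by
      dsimp only
      rw [Φ.app_map, hx', W.map_map, hη])
    rw [V.map_map] at h3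
    have h4 := gV.map_eq_zero hV hbar (by omega) (by omega) (by omega) le_rfl x' h3
    rw [← hx', hA (c - 1) (by omega) _ x' h4, map_zero]
  -- If `y` merged with something older before `b`, it would start a bar, and `exists_older` would
  -- move the older element back to `a - 1 - e`. This is early enough for `hD` to kill it, since `a
  -- ≤ c`.
  have hE : ∀ y' : W.obj (a - 1), W.map (show a - 1 ≤ b by omega) y' ≠
      W.map hcb (Φ.app c x) := by
    intro y' hy'
    obtain ⟨b', hb', hb'b, hbar'⟩ := exists_hasBar (r := a - 1) hac hcb y
      (fun r hr z => hy ▸ hamin r hr z) (by omega) y' (by rw [hy', ← hy, W.map_map])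
    obtain ⟨y'', hy''⟩ := gW.exists_older hW hbar' (by omega) (by omega) y'
    have h1 : W.map (show a - 1 - e ≤ b by omega) y'' = W.map hcb (Φ.app c x) := by
      rw [← hy', ← W.map_map (s := b' + 1) (by omega) (by omega), hy'', W.map_map]
    have h2 := hD (a - 1 - e) (by omega) y'' (by
      rw [← W.map_map (s := b) (by omega) (hsucc b), h1, hz1])
    exact hz (by rw [← h1, ← W.map_map (s := c - 1) (by omega) (by omega), h2, map_zero])
  -- The gap and `hA` show that `z` comes from `c - 1 - e`. The sum then comes from the later of `a
  -- - 1` and `c - 1 - e`, which `hE` or `hD` excludes.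
  have hS : ∀ (y' : W.obj (a - 1)) (z : V.obj (c - 1)),
      W.map (show a - 1 ≤ b by omega) y' + W.map (show c - 1 ≤ b by omega) (Φ.app _ z) ≠
      W.map hcb (Φ.app c x) := by
    intro y' z h
    obtain ⟨z', hz'⟩ := gV.exists_older hV hbar (by omega) (by omega) z
    have hzz : z = V.map (show c - 1 - e ≤ c - 1 by omega) z' := by
      rw [← sub_eq_zero]
      refine hA (c - 1) (by omega) (by omega) _ ?_
      rw [map_sub, V.map_map, hz', sub_self]
    rw [hzz, Φ.app_map, W.map_map] at h
    rcases le_or_gt (c - 1 - e) (a - 1) with hle | hlt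
    · refine hE (y' + W.map hle (Φ.app _ z')) ?_
      rw [map_add, W.map_map, h]
    · have h1 : W.map (show c - 1 - e ≤ b by omega) (W.map hlt.le y' + Φ.app _ z') =
          W.map hcb (Φ.app c x) := by
        rw [map_add, W.map_map, h]
      have h2 := hD (c - 1 - e) (by omega) (W.map hlt.le y' + Φ.app _ z') (by
        rw [← W.map_map (s := b) (by omega) (hsucc b), h1, hz1])
      exact hz (by rw [← h1, ← W.map_map (s := c - 1) (by omega) (by omega), h2, map_zero])
  obtain ⟨q, hq, hqz⟩ := exists_dual_eq_one_of_notMem (F := F)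
    (S := LinearMap.range (W.map (show a - 1 ≤ b by omega)) ⊔
      LinearMap.range (W.map (show c - 1 ≤ b by omega) ∘ₗ Φ.app (c - 1)))
    (x := W.map hcb (Φ.app c x)) (by
      intro hmem
      obtain ⟨_, ⟨y', rfl⟩, _, ⟨z, rfl⟩, h⟩ := Submodule.mem_sup.1 hmem
      exact hS y' z h)
  -- The left inverse extends `q ∘ Φ` from V_b to V_d. The extension kills what is older than `c`,
  -- because that passes through V_b and `q` kills `Φ` of V_{c-1}.
  obtain ⟨g, hg⟩ := LinearMap.exists_leftInverse_of_injective (V.map hbd)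
    (LinearMap.ker_eq_bot'.2 fun z hz => hinj b hbd z hz)
  have hpq : ∀ z : V.obj b, q (Φ.app b z) = (q ∘ₗ Φ.app b ∘ₗ g) (V.map hbd z) := fun z => by
    rw [LinearMap.comp_apply, LinearMap.comp_apply]
    exact congrArg (fun u => q (Φ.app b u)) (LinearMap.congr_fun hg z).symm
  refine ⟨.R ⟨(a, b), hac.trans hcb⟩ ⟨(c, d), hcd⟩ ⟨hac, hcb, hbd⟩,
    nonempty_retract_R (L := ⟨V, W, Φ⟩) _ x y hxdies (fun t ht hbt => ?_) hy.symm
      (q ∘ₗ Φ.app b ∘ₗ g) q (fun s hs z => ?_) (fun s hs z => ?_) hpq ?_⟩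
  · dsimp only at ht hbt ⊢
    rw [← W.map_map hac (show c ≤ t by omega), hy, hbdies t _ hbt]
  · dsimp only at hs ⊢
    rw [← V.map_map (show s ≤ b by omega) hbd, ← hpq]
    refine hq _ (Submodule.mem_sup_right ⟨V.map (show s ≤ c - 1 by omega) z, ?_⟩)
    rw [LinearMap.comp_apply, ← Φ.app_map, V.map_map]
  · dsimp only at hs ⊢
    exact hq _ (Submodule.mem_sup_left ⟨W.map (show s ≤ a - 1 by omega) z, W.map_map _ _ _⟩)
  · dsimp only
    rw [← V.map_map hcb hbd, ← hpq, Φ.app_map, hqz]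

theorem exists_retract {L : LadderModule.{u, v, w} F}
    (hV : L.source.IsFinite) (hW : L.target.IsFinite) {e : ℤ} (he : 0 ≤ e) (hL : L.AlmostIso e)
    (gV : L.source.NestedGap e) (gW : L.target.NestedGap e)
    (h0 : ¬∀ t, Subsingleton (L.source.obj t) ∧ Subsingleton (L.target.obj t)) :
    ∃ E : ElementaryType, Nonempty ((elementary F E).Retract L) := by
  by_cases hs : ∀ t, Subsingleton (L.source.obj t)
  · push Not at h0
    obtain ⟨t, ht⟩ := h0
    have := ht (hs t)
    obtain ⟨y, hy⟩ := exists_ne (0 : L.target.obj t)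
    obtain ⟨a, b, hab⟩ := exists_hasBar_of_ne_zero hW hy
    exact ⟨.IMinus ⟨(a, b), hab.1⟩, nonempty_retract_IMinus hs hab⟩
  · push Not at hs
    obtain ⟨t, ht⟩ := hs
    obtain ⟨x, hx⟩ := exists_ne (0 : L.source.obj t)
    exact exists_retract_of_source_ne_zero hV hW he hL gV gW hx

/-! ### Splitting off a retract of a ladder module -/

/-- The complement of a retract. -/
@[reducible] def Retract.compl {M : LadderModule.{u, v', w'} F} {L : LadderModule.{u, v, w} F}
    (r : M.Retract L) : LadderModule.{u, v, w} F where
  source := kernel r.p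
  target := kernel r.p'
  hom :=
    { app := fun t => kernelProjApp r.i' r.p' r.p'_i' t ∘ₗ L.hom.app t ∘ₗ (kernelIncl r.p).app t
      naturality := fun {s t} h => LinearMap.ext fun x => by
        change (kernelProj r.i' r.p' r.p'_i').app t
            (L.hom.app t ((kernelIncl r.p).app t ((kernel r.p).map h x))) =
          (kernel r.p').map h ((kernelProj r.i' r.p' r.p'_i').app s
            (L.hom.app s ((kernelIncl r.p).app s x)))
        simp only [Hom.app_map] }

/-- By `comm_p` the morphism already sends ker p into ker p', so the projection in its restriction
changes nothing. -/
theorem Retract.kernelIncl_compl_hom {M : LadderModule.{u, v', w'} F}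
    {L : LadderModule.{u, v, w} F} (r : M.Retract L) (t : ℤ) (x : r.compl.source.obj t) :
    (kernelIncl r.p').app t (r.compl.hom.app t x) = L.hom.app t ((kernelIncl r.p).app t x) := by
  refine (kernelIncl_kernelProj r.i' r.p' r.p'_i' t _).trans ?_
  rw [LinearMap.comp_apply, ← r.comm_p, app_kernelIncl, map_zero, map_zero, sub_zero]

theorem Retract.compl_hom_kernelProj {M : LadderModule.{u, v', w'} F}
    {L : LadderModule.{u, v, w} F} (r : M.Retract L) (t : ℤ) (x : L.source.obj t) :
    r.compl.hom.app t ((kernelProj r.i r.p r.p_i).app t x) =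
      (kernelProj r.i' r.p' r.p'_i').app t (L.hom.app t x) := by
  apply kernelIncl_injective
  rw [r.kernelIncl_compl_hom, kernelIncl_kernelProj, kernelIncl_kernelProj, map_sub, r.comm_i,
    r.comm_p]

theorem AlmostIso.compl {M : LadderModule.{u, v', w'} F} {L : LadderModule.{u, v, w} F} {e : ℤ}
    (hL : L.AlmostIso e) (r : M.Retract L) : r.compl.AlmostIso e where
  ker {s t} h hst x hx := by
    apply kernelIncl_injective
    refine ((kernelIncl r.p).app_map h x).trans ?_
    rw [map_zero]
    refine hL.ker h hst _ ?_
    rw [← r.kernelIncl_compl_hom, hx, map_zero]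
  coker {s t} h hst y := by
    obtain ⟨x, hx⟩ := hL.coker h hst ((kernelIncl r.p').app s y)
    refine ⟨(kernelProj r.i r.p r.p_i).app t x, ?_⟩
    rw [r.compl_hom_kernelProj, hx, Hom.app_map, kernelProj_kernelIncl]

/-- The decomposition of `L` obtained from a retract and a decomposition of its complement. -/
noncomputable def Retract.iso {ι : Type} {N : Option ι → LadderModule.{u, v', w'} F}
    {L : LadderModule.{u, v, w} F} (r : (N none).Retract L)
    (e : r.compl.Iso (directSum fun j => N (some j))) : L.Iso (directSum N) where
  source := isoOfRetract (N := fun o => (N o).source) r.i r.p r.p_i e.source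
  target := isoOfRetract (N := fun o => (N o).target) r.i' r.p' r.p'_i' e.target
  comm t x := by
    refine directSum_ext fun j => ?_
    cases j with
    | none => exact (r.comm_p t x).symm
    | some j =>
      exact congrArg ((component (fun j => (N (some j)).target) j).app t)
        ((congrArg (e.target.app t) (r.compl_hom_kernelProj t x)).symm.trans (e.comm t _))

/-- Reindexing of a direct sum decomposition of a ladder module. -/
noncomputable def Iso.reindex {ι κ : Type} {L : LadderModule.{u, v, w} F} (h : ι ≃ κ)
    (M : κ → LadderModule.{u, v', w'} F) (e : L.Iso (directSum fun i => M (h i))) :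
    L.Iso (directSum M) where
  source := PersistenceModule.Iso.reindex h (fun k => (M k).source) e.source
  target := PersistenceModule.Iso.reindex h (fun k => (M k).target) e.target
  comm t x := by
    refine directSum_ext fun k => ?_
    obtain ⟨i, rfl⟩ := h.surjective k
    refine (component_reindex h (fun k => (M k).target) e.target t _ _).trans ?_
    refine Eq.trans ?_ (congrArg ((M (h i)).hom.app t)
      (component_reindex h (fun k => (M k).source) e.source t x _)).symm
    exact congrArg ((component (fun i => (M (h i)).target) i).app t) (e.comm t x)

/-! ### Existence of ladder decompositions -/

/-- An elementary ladder module is not zero. -/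
theorem exists_elementary_ne_zero (F : Type u) [Field F] (E : ElementaryType) :
    ∃ t, (∃ x : (elementary F E).source.obj t, x ≠ 0) ∨
      ∃ y : (elementary F E).target.obj t, y ≠ 0 := by
  cases E with
  | R K J h => exact ⟨_, Or.inl ⟨_, intervalGen_ne_zero (fst_mem J)⟩⟩
  | IPlus J => exact ⟨_, Or.inl ⟨_, intervalGen_ne_zero (fst_mem J)⟩⟩
  | IMinus K => exact ⟨_, Or.inr ⟨_, intervalGen_ne_zero (fst_mem K)⟩⟩

/-- Induction on the total dimension of source and target. The hypotheses are stable under passing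
to the complement of a retract, and an elementary retract is nonzero at some index. -/
theorem exists_iso_directSum_elementary {e : ℤ} (he : 0 ≤ e) (a b : ℤ) (n : ℕ)
    (L : LadderModule.{u, v, w} F) (hV : L.source.IsFinite) (hW : L.target.IsFinite)
    (hL : L.AlmostIso e) (gV : L.source.NestedGap e) (gW : L.target.NestedGap e)
    (hab : ∀ t, t < a ∨ b < t → Subsingleton (L.source.obj t) ∧ Subsingleton (L.target.obj t))
    (hn : ∑ t ∈ Finset.Icc a b,
      (Module.finrank F (L.source.obj t) + Module.finrank F (L.target.obj t)) ≤ n) :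
    ∃ (ι : Type) (_ : Fintype ι) (f : ι → ElementaryType),
      Nonempty (L.Iso (directSum fun i => elementary F (f i))) := by
  induction n generalizing L with
  | zero =>
    have h0 : ∀ t, Subsingleton (L.source.obj t) ∧ Subsingleton (L.target.obj t) := fun t => by
      by_cases ht : t ∈ Finset.Icc a b
      · have := hV.finiteDimensional t
        have := hW.finiteDimensional t
        rw [Nat.le_zero, Finset.sum_eq_zero_iff] at hn
        have := hn t ht
        exact ⟨Module.finrank_zero_iff (R := F).1 (by omega),
          Module.finrank_zero_iff (R := F).1 (by omega)⟩
      · exact hab t (by rw [Finset.mem_Icc] at ht; omega)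
    exact ⟨PEmpty, inferInstance, PEmpty.elim,
      ⟨⟨isoOfSubsingleton (fun t => (h0 t).1) (subsingleton_directSum_obj _),
        isoOfSubsingleton (fun t => (h0 t).2) (subsingleton_directSum_obj _),
        fun t x => (subsingleton_directSum_obj _ t).elim _ _⟩⟩⟩
  | succ n ih =>
    by_cases h0 : ∀ t, Subsingleton (L.source.obj t) ∧ Subsingleton (L.target.obj t)
    · exact ⟨PEmpty, inferInstance, PEmpty.elim,
        ⟨⟨isoOfSubsingleton (fun t => (h0 t).1) (subsingleton_directSum_obj _),
          isoOfSubsingleton (fun t => (h0 t).2) (subsingleton_directSum_obj _),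
          fun t x => (subsingleton_directSum_obj _ t).elim _ _⟩⟩⟩
    obtain ⟨E, ⟨r⟩⟩ := exists_retract hV hW he hL gV gW h0
    obtain ⟨c, hc⟩ := exists_elementary_ne_zero F E
    have hle : ∀ t, Module.finrank F (r.compl.source.obj t) +
        Module.finrank F (r.compl.target.obj t) ≤
        Module.finrank F (L.source.obj t) + Module.finrank F (L.target.obj t) := fun t =>
      Nat.add_le_add (finrank_kernel_le hV r.p t) (finrank_kernel_le hW r.p' t)
    have hlt : Module.finrank F (r.compl.source.obj c) +
        Module.finrank F (r.compl.target.obj c) <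
        Module.finrank F (L.source.obj c) + Module.finrank F (L.target.obj c) := by
      rcases hc with ⟨x, hx⟩ | ⟨y, hy⟩
      · exact Nat.add_lt_add_of_lt_of_le (finrank_kernel_lt hV r.i r.p r.p_i hx)
          (finrank_kernel_le hW r.p' c)
      · exact Nat.add_lt_add_of_le_of_lt (finrank_kernel_le hV r.p c)
          (finrank_kernel_lt hW r.i' r.p' r.p'_i' hy)
    obtain ⟨ι, hι, f, ⟨φ⟩⟩ := ih r.compl (hV.kernel r.p) (hW.kernel r.p') (hL.compl r)
      (gV.kernel r.i r.p r.p_i) (gW.kernel r.i' r.p' r.p'_i')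
      (fun s hs => by
        obtain ⟨h1, h2⟩ := hab s hs
        exact ⟨inferInstanceAs (Subsingleton (LinearMap.ker (r.p.app s))),
          inferInstanceAs (Subsingleton (LinearMap.ker (r.p'.app s)))⟩) (by
      refine Nat.le_of_lt_succ (lt_of_lt_of_le ?_ hn)
      refine Finset.sum_lt_sum (fun s _ => hle s) ⟨c, ?_, hlt⟩
      by_contra hc
      obtain ⟨h1, h2⟩ := hab c (by rw [Finset.mem_Icc] at hc; omega)
      rw [Module.finrank_zero_of_subsingleton (M := L.source.obj c),
        Module.finrank_zero_of_subsingleton (M := L.target.obj c)] at hlt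
      exact absurd hlt (Nat.not_lt_zero _))
    exact ⟨Option ι, inferInstance, fun o => o.elim E f,
      ⟨Retract.iso (N := fun o : Option ι => elementary F (o.elim E f)) r φ⟩⟩

/-- A morphism with almost vanishing kernel and cokernel has a ladder decomposition if strictly
nested bars are far apart. -/
theorem AlmostIso.exists_isLadderDecomposition {L : LadderModule.{u, v, w} F} {e : ℤ}
    (hL : L.AlmostIso e) (he : 0 ≤ e) (hV : L.source.IsFinite) (hW : L.target.IsFinite)
    (gV : L.source.NestedGap e) (gW : L.target.NestedGap e) :
    ∃ m, L.IsLadderDecomposition m := by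
  obtain ⟨a, b, hab⟩ := hV.bounded
  obtain ⟨a', b', hab'⟩ := hW.bounded
  obtain ⟨ι, hι, f, ⟨φ⟩⟩ := exists_iso_directSum_elementary he (min a a') (max b b') _ L hV hW hL
    gV gW (fun t ht => ⟨hab t (by omega), hab' t (by omega)⟩) le_rfl
  obtain ⟨m, h, rfl⟩ := exists_equiv_sigma_fin f
  exact ⟨m, ⟨φ.reindex h fun k => elementary F k.1⟩⟩

end LadderModule

namespace PersistenceModule

variable {F : Type u} [Field F]

/-! ### Inclusions of summands -/

open Classical in
/-- The inclusion of a summand of a direct sum. -/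
noncomputable def incl {ι : Type} (M : ι → PersistenceModule.{u, w} F) (i : ι) :
    (M i).Hom (directSum M) where
  app t := DirectSum.lof F ι (fun i => (M i).obj t) i
  naturality h := LinearMap.ext fun x =>
    (DirectSum.lmap_lof (fun i => (M i).map h) i x).symm

theorem component_incl_self {ι : Type} (M : ι → PersistenceModule.{u, w} F) (i : ι) (t : ℤ)
    (x : (M i).obj t) : (component M i).app t ((incl M i).app t x) = x := by
  classical
  exact DirectSum.component.lof_self (R := F) (M := fun i => (M i).obj t) i x

theorem component_incl_of_ne {ι : Type} (M : ι → PersistenceModule.{u, w} F) {i j : ι}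
    (hij : j ≠ i) (t : ℤ) (x : (M j).obj t) :
    (component M i).app t ((incl M j).app t x) = 0 := by
  classical
  exact DirectSum.of_eq_of_ne (β := fun i => (M i).obj t) j i x hij.symm

theorem directSum_functional_eq_zero {ι : Type} {M : ι → PersistenceModule.{u, w} F} {t : ℤ}
    (g : (directSum M).obj t →ₗ[F] F) (x : (directSum M).obj t)
    (h : ∀ i, g ((incl M i).app t ((component M i).app t x)) = 0) : g x = 0 := by
  classical
  have hx := DirectSum.sum_support_of (β := fun i => (M i).obj t) x
  refine (congrArg g hx.symm).trans ?_
  refine (map_sum g _ _).trans (Finset.sum_eq_zero fun i _ => ?_)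
  exact h i

/-- The morphism underlying an isomorphism. -/
def Iso.toHom {V : PersistenceModule.{u, v} F} {W : PersistenceModule.{u, w} F} (e : V.Iso W) :
    V.Hom W where
  app t := (e.app t).toLinearMap
  naturality h := LinearMap.ext fun x => e.naturality h x

/-- The inverse of an isomorphism, as a morphism. -/
def Iso.invHom {V : PersistenceModule.{u, v} F} {W : PersistenceModule.{u, w} F} (e : V.Iso W) :
    W.Hom V where
  app t := (e.app t).symm.toLinearMap
  naturality h := LinearMap.ext fun x => (e.app _).injective <| by
    change e.app _ ((e.app _).symm _) = e.app _ (V.map h ((e.app _).symm x))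
    rw [e.naturality, LinearEquiv.apply_symm_apply, LinearEquiv.apply_symm_apply]

theorem Iso.toHom_invHom {V : PersistenceModule.{u, v} F} {W : PersistenceModule.{u, w} F}
    (e : V.Iso W) (t : ℤ) (x : W.obj t) : e.toHom.app t (e.invHom.app t x) = x :=
  (e.app t).apply_symm_apply x

theorem Iso.invHom_toHom {V : PersistenceModule.{u, v} F} {W : PersistenceModule.{u, w} F}
    (e : V.Iso W) (t : ℤ) (x : V.obj t) : e.invHom.app t (e.toHom.app t x) = x :=
  (e.app t).symm_apply_apply x

/-- Composition of morphisms. -/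
def Hom.comp {U : PersistenceModule.{u, v'} F} {V : PersistenceModule.{u, v} F}
    {W : PersistenceModule.{u, w} F} (g : V.Hom W) (f : U.Hom V) : U.Hom W where
  app t := g.app t ∘ₗ f.app t
  naturality h := LinearMap.ext fun x => by simp [Hom.app_map]

/-- The inclusion of a summand in a direct sum decomposition. -/
noncomputable def Iso.incl {ι : Type} {M : ι → PersistenceModule.{u, w} F}
    {V : PersistenceModule.{u, v} F} (e : V.Iso (directSum M)) (i : ι) : (M i).Hom V :=
  e.invHom.comp (PersistenceModule.incl M i)

/-- The projection to a summand in a direct sum decomposition. -/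
noncomputable def Iso.proj {ι : Type} {M : ι → PersistenceModule.{u, w} F}
    {V : PersistenceModule.{u, v} F} (e : V.Iso (directSum M)) (i : ι) : V.Hom (M i) :=
  (component M i).comp e.toHom

theorem Iso.proj_incl_self {ι : Type} {M : ι → PersistenceModule.{u, w} F}
    {V : PersistenceModule.{u, v} F} (e : V.Iso (directSum M)) (i : ι) (t : ℤ)
    (x : (M i).obj t) : (e.proj i).app t ((e.incl i).app t x) = x :=
  (congrArg ((component M i).app t) (e.toHom_invHom t _)).trans (component_incl_self M i t x)

theorem Iso.proj_incl_of_ne {ι : Type} {M : ι → PersistenceModule.{u, w} F}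
    {V : PersistenceModule.{u, v} F} (e : V.Iso (directSum M)) {i j : ι} (hij : j ≠ i) (t : ℤ)
    (x : (M j).obj t) : (e.proj i).app t ((e.incl j).app t x) = 0 :=
  (congrArg ((component M i).app t) (e.toHom_invHom t _)).trans (component_incl_of_ne M hij t x)

theorem Iso.functional_eq_zero {ι : Type} {M : ι → PersistenceModule.{u, w} F}
    {V : PersistenceModule.{u, v} F} (e : V.Iso (directSum M)) {t : ℤ} (g : V.obj t →ₗ[F] F)
    (x : V.obj t) (h : ∀ i, g ((e.incl i).app t ((e.proj i).app t x)) = 0) : g x = 0 := by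
  rw [← e.invHom_toHom t x]
  exact directSum_functional_eq_zero (g ∘ₗ e.invHom.app t) _ h

/-- A functional that detects the summand `k_J` vanishes on the other summands. -/
theorem functional_interval_eq_zero {V : PersistenceModule.{u, v} F} {J J' : NonemptyInterval ℤ}
    (κ : (interval F J').Hom V) (g : V.obj J.snd →ₗ[F] F)
    (hg : ∀ s (hs : s < J.fst) (y : V.obj s), g (V.map (hs.le.trans J.fst_le_snd) y) = 0) {c : ℤ}
    (hac : J.fst ≤ c) (hcb : c ≤ J.snd) (z : (interval F J').obj c)
    (hz : ∃ z₀, (interval F J').map hac z₀ = z)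
    (hz' : ∀ t (ht : c ≤ t), J.snd < t → (interval F J').map ht z = 0) (hne : J' ≠ J) :
    g (V.map hcb (κ.app c z)) = 0 := by
  by_cases hz0 : z = 0
  · rw [hz0, map_zero, map_zero, map_zero]
  have hc : c ∈ J' := by
    by_contra h
    exact hz0 (interval_eq_zero h z)
  -- A nonzero `z` forces both endpoints of `J'` to be at most those of `J`. If the left one is
  -- smaller, `z` is too old for `g`; if only the right one is smaller, `z` is dead at `J.snd`.
  have h1 : J'.fst ≤ J.fst := by
    by_contra! h
    obtain ⟨z₀, rfl⟩ := hz
    rw [interval_eq_zero (fun h' => absurd h'.1 h.not_ge) z₀, map_zero] at hz0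
    exact hz0 rfl
  have h2 : J'.snd ≤ J.snd := by
    by_contra! h
    refine hz0 (intervalVal_injective _ _ ?_)
    rw [← intervalVal_map hc.2 (snd_mem J'), hz' _ _ h, map_zero, map_zero]
  rcases h1.lt_or_eq with h1 | h1
  · have : z = (interval F J').map hc.1 (intervalVal F J' c z • intervalGen F (fst_mem J')) := by
      apply intervalVal_injective
      rw [intervalVal_map hc.1 hc, map_smul, intervalVal_intervalGen, smul_eq_mul, mul_one]
    rw [this, κ.app_map, V.map_map, hg _ h1]
  rcases h2.lt_or_eq with h2 | h2
  · rw [← κ.app_map, interval_eq_zero (fun h' => absurd h'.2 h2.not_ge) ((interval F J').map _ _),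
      map_zero, map_zero]
  · exact absurd (NonemptyInterval.ext (Prod.ext h1 h2)) hne

end PersistenceModule

namespace LadderModule

open PersistenceModule

variable {F : Type u} [Field F]

/-! ### Multiplicities in ladder decompositions -/

theorem directSum_hom_incl {ι : Type} (M : ι → LadderModule.{u, v, w} F) (i : ι) (t : ℤ)
    (x : (M i).source.obj t) :
    (directSum M).hom.app t ((incl (fun i => (M i).source) i).app t x) =
      (incl (fun i => (M i).target) i).app t ((M i).hom.app t x) := by
  classical
  exact DirectSum.lmap_lof (fun j => (M j).hom.app t) i x

/-- A decomposition of a ladder module decomposes the source. -/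
def Iso.src {ι : Type} {M : ι → LadderModule.{u, v', w'} F} {L : LadderModule.{u, v, w} F}
    (φ : L.Iso (directSum M)) :
    L.source.Iso (PersistenceModule.directSum fun i => (M i).source) :=
  φ.source

/-- A decomposition of a ladder module decomposes the target. -/
def Iso.tgt {ι : Type} {M : ι → LadderModule.{u, v', w'} F} {L : LadderModule.{u, v, w} F}
    (φ : L.Iso (directSum M)) :
    L.target.Iso (PersistenceModule.directSum fun i => (M i).target) :=
  φ.target

theorem Iso.hom_incl {ι : Type} {M : ι → LadderModule.{u, v', w'} F}
    {L : LadderModule.{u, v, w} F} (φ : L.Iso (directSum M)) (i : ι) (t : ℤ)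
    (x : (M i).source.obj t) :
    L.hom.app t ((φ.src.incl i).app t x) = (φ.tgt.incl i).app t ((M i).hom.app t x) := by
  apply (φ.target.app t).injective
  refine (φ.comm t _).trans (Eq.trans ?_ (φ.target.toHom_invHom t _).symm)
  exact (congrArg _ (φ.source.toHom_invHom t _)).trans (directSum_hom_incl M i t x)

theorem Iso.proj_hom {ι : Type} {M : ι → LadderModule.{u, v', w'} F}
    {L : LadderModule.{u, v, w} F} (φ : L.Iso (directSum M)) (i : ι) (t : ℤ)
    (x : L.source.obj t) :
    (φ.tgt.proj i).app t (L.hom.app t x) = (M i).hom.app t ((φ.src.proj i).app t x) :=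
  congrArg ((component (fun i => (M i).target) i).app t) (φ.comm t x)

/-- Data at the endpoints of `J` and `K` exhibiting `r` copies of `R_K^J` as a retract. -/
structure Copies (L : LadderModule.{u, v, w} F) (K J : NonemptyInterval ℤ) (h : Overlap K J)
    (r : ℕ) where
  x : Fin r → L.source.obj J.fst
  y : Fin r → L.target.obj K.fst
  g : Fin r → (L.source.obj J.snd →ₗ[F] F)
  k : Fin r → (L.target.obj K.snd →ₗ[F] F)
  map_x : ∀ p t (ht : J.fst ≤ t), J.snd < t → L.source.map ht (x p) = 0
  map_y : ∀ p t (ht : K.fst ≤ t), K.snd < t → L.target.map ht (y p) = 0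
  g_map : ∀ p s (hs : s < J.fst) (z : L.source.obj s),
    g p (L.source.map (hs.le.trans J.fst_le_snd) z) = 0
  k_map : ∀ p s (hs : s < K.fst) (z : L.target.obj s),
    k p (L.target.map (hs.le.trans K.fst_le_snd) z) = 0
  hom_x : ∀ p, L.hom.app J.fst (x p) = L.target.map h.1 (y p)
  k_hom : ∀ p (z : L.source.obj K.snd), k p (L.hom.app K.snd z) = g p (L.source.map h.2.2 z)
  g_x : ∀ p q, g p (L.source.map J.fst_le_snd (x q)) = if q = p then 1 else 0

/-- A ladder decomposition contains as many copies of `R_K^J` as its multiplicity says. -/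
theorem IsLadderDecomposition.nonempty_copies {L : LadderModule.{u, v, w} F}
    {m : ElementaryType → ℕ} (hm : L.IsLadderDecomposition m) {K J : NonemptyInterval ℤ}
    (h : Overlap K J) : Nonempty (L.Copies K J h (m (.R K J h))) := by
  obtain ⟨φ⟩ := hm
  let i : Fin (m (.R K J h)) → (interval F J).Hom L.source := fun p =>
    φ.src.incl ⟨.R K J h, p⟩
  let i' : Fin (m (.R K J h)) → (interval F K).Hom L.target := fun p =>
    φ.tgt.incl ⟨.R K J h, p⟩
  let c : Fin (m (.R K J h)) → L.source.Hom (interval F J) := fun p =>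
    φ.src.proj ⟨.R K J h, p⟩
  let c' : Fin (m (.R K J h)) → L.target.Hom (interval F K) := fun p =>
    φ.tgt.proj ⟨.R K J h, p⟩
  have hci : ∀ p t z, (c p).app t ((i p).app t z) = z := fun p =>
    φ.src.proj_incl_self ⟨.R K J h, p⟩
  have hci' : ∀ p q, q ≠ p → ∀ t z, (c p).app t ((i q).app t z) = 0 := fun p q hpq =>
    φ.src.proj_incl_of_ne (i := ⟨.R K J h, p⟩) (j := ⟨.R K J h, q⟩)
      fun h => hpq (by simpa using h)
  have hi : ∀ p t z, L.hom.app t ((i p).app t z) = (i' p).app t ((overlapHom F h).app t z) :=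
    fun p => φ.hom_incl ⟨.R K J h, p⟩
  have hc : ∀ p t z, (c' p).app t (L.hom.app t z) = (overlapHom F h).app t ((c p).app t z) :=
    fun p => φ.proj_hom ⟨.R K J h, p⟩
  refine ⟨⟨fun p => (i p).app J.fst (intervalGen F (fst_mem J)),
    fun p => (i' p).app K.fst (intervalGen F (fst_mem K)),
    fun p => intervalVal F J J.snd ∘ₗ (c p).app J.snd,
    fun p => intervalVal F K K.snd ∘ₗ (c' p).app K.snd,
    fun p t ht hJt => ?_, fun p t ht hKt => ?_, fun p s hs z => ?_, fun p s hs z => ?_,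
    fun p => ?_, fun p z => ?_, fun p q => ?_⟩⟩
  · rw [← Hom.app_map, interval_eq_zero (fun h' => absurd h'.2 hJt.not_ge) (map _ _ _), map_zero]
  · rw [← Hom.app_map, interval_eq_zero (fun h' => absurd h'.2 hKt.not_ge) (map _ _ _), map_zero]
  · rw [LinearMap.comp_apply, Hom.app_map,
      interval_eq_zero (fun h' => absurd h'.1 hs.not_ge) ((c p).app s z), map_zero, map_zero]
  · rw [LinearMap.comp_apply, Hom.app_map,
      interval_eq_zero (fun h' => absurd h'.1 hs.not_ge) ((c' p).app s z), map_zero, map_zero]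
  · rw [hi, ← Hom.app_map]
    refine congrArg ((i' p).app _) (intervalVal_injective _ _ ?_)
    have hJK : J.fst ∈ K := ⟨h.1, h.2.1⟩
    rw [intervalVal_overlapHom h hJK, intervalVal_map h.1 hJK, intervalVal_intervalGen,
      intervalVal_intervalGen]
  · rw [LinearMap.comp_apply, LinearMap.comp_apply, hc, intervalVal_overlapHom h (snd_mem K),
      Hom.app_map, intervalVal_map h.2.2 (snd_mem J)]
  · rw [LinearMap.comp_apply, ← Hom.app_map]
    split_ifs with hpq
    · subst hpq
      rw [hci, intervalVal_map J.fst_le_snd (snd_mem J), intervalVal_intervalGen]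
    · rw [hci' p q hpq, map_zero]

/-- Functionals that detect `R_K^J` vanish on the other elementary ladder modules. -/
theorem functional_elementary_eq_zero {L : LadderModule.{u, v, w} F} {K J : NonemptyInterval ℤ}
    (h : Overlap K J) (E : ElementaryType) (hE : E ≠ .R K J h)
    (κ : (elementary F E).source.Hom L.source) (κ' : (elementary F E).target.Hom L.target)
    (hκ : ∀ t z, L.hom.app t (κ.app t z) = κ'.app t ((elementary F E).hom.app t z))
    (g : L.source.obj J.snd →ₗ[F] F) (k : L.target.obj K.snd →ₗ[F] F)
    (hg : ∀ s (hs : s < J.fst) (z : L.source.obj s),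
      g (L.source.map (hs.le.trans J.fst_le_snd) z) = 0)
    (hk : ∀ s (hs : s < K.fst) (z : L.target.obj s),
      k (L.target.map (hs.le.trans K.fst_le_snd) z) = 0)
    (hgk : ∀ z : L.source.obj J.fst,
      k (L.target.map h.2.1 (L.hom.app J.fst z)) = g (L.source.map J.fst_le_snd z))
    (z : (elementary F E).source.obj J.fst)
    (hz : ∀ t (ht : J.fst ≤ t), J.snd < t → (elementary F E).source.map ht z = 0)
    (hz' : ∃ y, (elementary F E).target.map h.1 y = (elementary F E).hom.app J.fst z)
    (hz'' : ∀ t (ht : J.fst ≤ t), K.snd < t →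
      (elementary F E).target.map ht ((elementary F E).hom.app J.fst z) = 0) :
    g (L.source.map J.fst_le_snd (κ.app J.fst z)) = 0 := by
  cases E with
  | R K' J' h' =>
    by_cases hJ : J' = J
    · subst hJ
      have hK : K' ≠ K := by
        rintro rfl
        exact hE rfl
      -- Here the summand differs from R_K^J only in the target, so the test is moved there.
      rw [← hgk, hκ]
      exact functional_interval_eq_zero κ' k hk h.1 h.2.1 _ hz' hz'' hK
    · exact functional_interval_eq_zero κ g hg le_rfl J.fst_le_snd z ⟨z, map_rfl _ _ _⟩ hz hJ
  | IPlus J' =>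
    rw [← hgk, hκ]
    exact (congrArg (fun a => k (L.target.map h.2.1 a)) (map_zero (κ'.app J.fst))).trans
      (by rw [map_zero, map_zero])
  | IMinus K' =>
    exact (congrArg (fun a => g (L.source.map J.fst_le_snd a)) (map_zero (κ.app J.fst))).trans
      (by rw [map_zero, map_zero])

/-- An upper bound for the number of copies of `R_K^J` in a ladder decomposition. -/
theorem IsLadderDecomposition.le_mult {L : LadderModule.{u, v, w} F}
    {m : ElementaryType → ℕ} (hm : L.IsLadderDecomposition m) {K J : NonemptyInterval ℤ}
    (h : Overlap K J) {r : ℕ} (x : Fin r → L.source.obj J.fst)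
    (g : Fin r → (L.source.obj J.snd →ₗ[F] F)) (k : Fin r → (L.target.obj K.snd →ₗ[F] F))
    (hx : ∀ p t (ht : J.fst ≤ t), J.snd < t → L.source.map ht (x p) = 0)
    (hg : ∀ p s (hs : s < J.fst) (z : L.source.obj s),
      g p (L.source.map (hs.le.trans J.fst_le_snd) z) = 0)
    (hk : ∀ p s (hs : s < K.fst) (z : L.target.obj s),
      k p (L.target.map (hs.le.trans K.fst_le_snd) z) = 0)
    (hgk : ∀ p (z : L.source.obj J.fst),
      k p (L.target.map h.2.1 (L.hom.app J.fst z)) = g p (L.source.map J.fst_le_snd z))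
    (hy : ∀ p, ∃ y, L.target.map h.1 y = L.hom.app J.fst (x p))
    (hy' : ∀ p t (ht : J.fst ≤ t), K.snd < t → L.target.map ht (L.hom.app J.fst (x p)) = 0)
    (hgx : ∀ p q, g p (L.source.map J.fst_le_snd (x q)) = if q = p then 1 else 0) :
    r ≤ m (.R K J h) := by
  obtain ⟨φ⟩ := hm
  let ℓ : Fin (m (.R K J h)) → (L.source.obj J.fst →ₗ[F] F) := fun q =>
    intervalVal F J J.fst ∘ₗ (φ.src.proj ⟨.R K J h, q⟩).app J.fst
  -- `T` reads off the coordinates of `∑ a p • x p` in the copies of R_K^J. If they all vanish, only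
  -- other summands contribute to `a p`, the value of the `p`-th functional, and each contributes
  -- zero.
  let T : (Fin r → F) →ₗ[F] (Fin (m (.R K J h)) → F) :=
    LinearMap.pi ℓ ∘ₗ Fintype.linearCombination F x
  suffices hT : Function.Injective T by
    simpa using LinearMap.finrank_le_finrank_of_injective hT
  rw [← LinearMap.ker_eq_bot, LinearMap.ker_eq_bot']
  intro a ha
  set X := Fintype.linearCombination F x a with hX
  have hXsum : X = ∑ p, a p • x p := Fintype.linearCombination_apply F x a
  have hXℓ : ∀ q, ℓ q X = 0 := fun q => congrFun ha q
  have hXdies : ∀ t (ht : J.fst ≤ t), J.snd < t → L.source.map ht X = 0 := fun t ht hJt => by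
    rw [hXsum, map_sum]
    exact Finset.sum_eq_zero fun p _ => by rw [map_smul, hx p t ht hJt, smul_zero]
  have hXy : ∃ y, L.target.map h.1 y = L.hom.app J.fst X := by
    choose y hy using hy
    refine ⟨∑ p, a p • y p, ?_⟩
    rw [hXsum, map_sum, map_sum]
    exact Finset.sum_congr rfl fun p _ => by rw [map_smul, map_smul, hy]
  have hXy' : ∀ t (ht : J.fst ≤ t), K.snd < t → L.target.map ht (L.hom.app J.fst X) = 0 :=
    fun t ht hKt => by
      rw [hXsum, map_sum, map_sum]
      exact Finset.sum_eq_zero fun p _ => by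
        rw [map_smul, map_smul, hy' p t ht hKt, smul_zero]
  funext p
  have h1 : g p (L.source.map J.fst_le_snd X) = a p := by
    rw [hXsum, map_sum, map_sum]
    simp [hgx]
  rw [← h1, Pi.zero_apply]
  refine φ.src.functional_eq_zero (g p ∘ₗ L.source.map J.fst_le_snd) X fun j => ?_
  rw [LinearMap.comp_apply]
  obtain ⟨E, q⟩ := j
  by_cases hE : E = .R K J h
  · subst hE
    have : (φ.src.proj ⟨.R K J h, q⟩).app J.fst X = 0 :=
      intervalVal_injective J J.fst ((hXℓ q).trans (map_zero _).symm)
    rw [this, map_zero, map_zero, map_zero]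
  · refine functional_elementary_eq_zero h E hE (φ.src.incl ⟨E, q⟩) (φ.tgt.incl ⟨E, q⟩)
      (φ.hom_incl ⟨E, q⟩) (g p) (k p) (hg p) (hk p) (hgk p) _ (fun t ht hJt => ?_) ?_
      (fun t ht hKt => ?_)
    · exact ((φ.src.proj ⟨E, q⟩).app_map ht X).symm.trans (by rw [hXdies t ht hJt, map_zero])
    · obtain ⟨y, hy⟩ := hXy
      exact ⟨(φ.tgt.proj ⟨E, q⟩).app _ y,
        ((φ.tgt.proj ⟨E, q⟩).app_map _ y).symm.trans (by rw [hy, φ.proj_hom])⟩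
    · refine (congrArg ((elementary F E).target.map ht) (φ.proj_hom ⟨E, q⟩ _ X).symm).trans ?_
      exact ((φ.tgt.proj ⟨E, q⟩).app_map ht _).symm.trans (by rw [hXy' t ht hKt, map_zero])

end LadderModule

namespace PersistenceModule

variable {F : Type u} [Field F]

/-! ### Interleavings -/

theorem IsFinite.shift {V : PersistenceModule.{u, v} F} (hV : V.IsFinite) (δ : ℤ) :
    (V.shift δ).IsFinite where
  finiteDimensional t := hV.finiteDimensional (t + δ)
  bounded := by
    obtain ⟨a, b, hab⟩ := hV.bounded
    exact ⟨a - δ, b - δ, fun t ht => hab (t + δ) (by omega)⟩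

theorem HasBar.of_shift {V : PersistenceModule.{u, v} F} {δ a b : ℤ}
    (h : (V.shift δ).HasBar a b) : V.HasBar (a + δ) (b + δ) := by
  obtain ⟨hab, x, hx, hx'⟩ := h
  refine ⟨by omega, x, fun t ht hbt => ?_, fun s hs y => ?_⟩
  · obtain ⟨t, rfl⟩ : ∃ t', t = t' + δ := ⟨t - δ, by omega⟩
    exact hx t (by omega) (by omega)
  · obtain ⟨s, rfl⟩ : ∃ s', s = s' + δ := ⟨s - δ, by omega⟩
    exact hx' s (by omega) y

theorem NestedGap.shift {V : PersistenceModule.{u, v} F} {e : ℤ} (hV : V.NestedGap e) (δ : ℤ) :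
    (V.shift δ).NestedGap e := fun a b c d h h' hca hbd => by
  have := hV _ _ _ _ h.of_shift h'.of_shift (by omega) (by omega)
  omega

theorem nestedGap_of_lt_nestedness {V : PersistenceModule.{u, v} F} (hV : V.IsFinite) {n : ℕ}
    (hn : (n : ℕ∞) < V.nestedness) : V.NestedGap n := by
  intro a b c d h h' hca hbd
  have hI := HasBar.isBar (J := ⟨(a, b), h.1⟩) hV h
  have hJ := HasBar.isBar (J := ⟨(c, d), h'.1⟩) hV h'
  have h1 : V.nestedness ≤ ((min (a - c).natAbs (b - d).natAbs : ℕ) : ℕ∞) :=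
    (iInf_le _ ⟨(a, b), h.1⟩).trans <| (iInf_le _ ⟨(c, d), h'.1⟩).trans <|
      (iInf_le _ hI).trans <| (iInf_le _ hJ).trans <| iInf_le _ ⟨hca, hbd⟩
  have h2 := Nat.cast_lt.1 (hn.trans_le h1)
  omega

theorem IsInterleaving.symm {V : PersistenceModule.{u, v} F} {W : PersistenceModule.{u, w} F}
    {δ : ℕ} {Φ : V.Hom (W.shift δ)} {Ψ : W.Hom (V.shift δ)} (h : IsInterleaving δ Φ Ψ) :
    IsInterleaving δ Ψ Φ :=
  ⟨h.2, h.1⟩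

/-- The shift by 2δ factors through `Φ`, hence kills its kernel; `Ψ y` lifts the image of `y` under
this shift. -/
theorem IsInterleaving.almostIso {V : PersistenceModule.{u, v} F} {W : PersistenceModule.{u, w} F}
    {δ : ℕ} {Φ : V.Hom (W.shift δ)} {Ψ : W.Hom (V.shift δ)} (h : IsInterleaving δ Φ Ψ) :
    LadderModule.AlmostIso ⟨V, W.shift δ, Φ⟩ (2 * δ : ℕ) where
  ker {s t} hst hst' x hx := by
    dsimp only at x hx ⊢
    have h1 : s ≤ s + δ + δ := by omega
    rw [← V.map_map h1 (show s + δ + δ ≤ t by omega), ← h.1 s h1, hx, map_zero]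
    exact map_zero _
  coker {s t} hst hst' y := by
    dsimp only at y ⊢
    have h1 : s + δ ≤ s + δ + δ + δ := by omega
    have h2 : s + δ + δ ≤ t := by omega
    refine ⟨V.map h2 (Ψ.app (s + δ) y), ?_⟩
    rw [Φ.app_map]
    refine (congrArg _ (h.2 (s + δ) h1 y)).trans ?_
    exact W.map_map _ _ _

end PersistenceModule

/-! ### Comparison of multiplicities in an interleaving pair -/

namespace LadderModule

open PersistenceModule

variable {F : Type u} [Field F]

theorem multR_le_multR_of_isInterleaving {V : PersistenceModule.{u, v} F}
    {W : PersistenceModule.{u, w} F} {δ : ℕ} (hV : V.IsFinite) (gV : V.NestedGap (2 * δ : ℕ))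
    {Φ : V.Hom (W.shift δ)} {Ψ : W.Hom (V.shift δ)} (hΦΨ : IsInterleaving δ Φ Ψ)
    {mΦ mΨ : ElementaryType → ℕ} (hΦ : IsLadderDecomposition ⟨V, W.shift δ, Φ⟩ mΦ)
    (hΨ : IsLadderDecomposition ⟨W, V.shift δ, Ψ⟩ mΨ) (JV JW : NonemptyInterval ℤ)
    (hJV : 2 * (δ : ℤ) ≤ JV.length) (hJW : 2 * (δ : ℤ) ≤ JW.length) :
    multR mΦ (shiftBar JW δ) JV ≤ multR mΨ (shiftBar JV δ) JW := by
  by_cases h : Overlap (shiftBar JW δ) JV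
  swap
  · rw [multR, dif_neg h]
    exact Nat.zero_le _
  rw [multR, dif_pos h]
  -- One actual copy is needed below to compare the endpoints of the two bars.
  rcases Nat.eq_zero_or_pos (mΦ (.R (shiftBar JW δ) JV h)) with h0 | hpos
  · rw [h0]
    exact Nat.zero_le _
  obtain ⟨C⟩ := hΦ.nonempty_copies h
  generalize mΦ (.R (shiftBar JW δ) JV h) = r at C hpos
  obtain ⟨⟨a, b⟩, hab⟩ := JW
  obtain ⟨⟨c, d⟩, hcd⟩ := JV
  simp only [NonemptyInterval.length] at hJV hJW
  dsimp only at hab hcd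
  have hac : a ≤ c + δ := by have := h.1; simp only [shiftBar] at this; omega
  have hcb : c + δ ≤ b := by have := h.2.1; simp only [shiftBar] at this; omega
  have hbd : b ≤ d + δ := by have := h.2.2; simp only [shiftBar] at this; omega
  -- the data of the copies, with the shift unfolded
  obtain ⟨x, y₀, g, k₀, hx, hy₀, hg, hk₀, hxy₀, hgk₀, hgx⟩ :
      ∃ (x : Fin r → V.obj c) (y : Fin r → W.obj (a - δ + δ)) (g : Fin r → (V.obj d →ₗ[F] F))
        (k : Fin r → (W.obj (b - δ + δ) →ₗ[F] F)),
        (∀ p t (ht : c ≤ t), d < t → V.map ht (x p) = 0) ∧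
        (∀ p t (ht : a - δ ≤ t), b - δ < t → W.map (add_le_add_left ht (δ : ℤ)) (y p) = 0) ∧
        (∀ p s (hs : s < c) (z : V.obj s), g p (V.map (hs.le.trans hcd) z) = 0) ∧
        (∀ p s (hs : s < a - δ) (z : W.obj (s + δ)),
          k p (W.map (show s + δ ≤ b - δ + δ by omega) z) = 0) ∧
        (∀ p, Φ.app c (x p) = W.map (show a - δ + δ ≤ c + δ by omega) (y p)) ∧
        (∀ p (z : V.obj (b - δ)),
          k p (Φ.app (b - δ) z) = g p (V.map (show b - δ ≤ d by omega) z)) ∧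
        ∀ p q, g p (V.map hcd (x q)) = if q = p then 1 else 0 :=
    ⟨C.x, C.y, C.g, C.k, C.map_x, C.map_y, C.g_map, C.k_map, C.hom_x, C.k_hom, C.g_x⟩
  -- `a - δ + δ` and `a` are equal only propositionally; structure maps serve as transport.
  have ha : a - δ + δ ≤ a := by omega
  have hb : b ≤ b - δ + δ := by omega
  have hd : d - δ + δ ≤ d := by omega
  obtain ⟨k, hk⟩ : ∃ k : Fin r → (W.obj b →ₗ[F] F), ∀ p z, k p z = k₀ p (W.map hb z) :=
    ⟨fun p => k₀ p ∘ₗ W.map hb, fun _ _ => rfl⟩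
  obtain ⟨g', hg'⟩ : ∃ g' : Fin r → (V.obj (d - δ + δ) →ₗ[F] F),
      ∀ p z, g' p z = g p (V.map hd z) := ⟨fun p => g p ∘ₗ V.map hd, fun _ _ => rfl⟩
  obtain ⟨y, hy_def⟩ : ∃ y : Fin r → W.obj a, ∀ p, y p = W.map ha (y₀ p) := ⟨_, fun _ => rfl⟩
  have hy : ∀ p t (ht : a ≤ t), b < t → W.map ht (y p) = 0 := by
    intro p t ht hbt
    obtain ⟨t, rfl⟩ : ∃ t', t = t' + δ := ⟨t - δ, by omega⟩
    rw [hy_def, W.map_map]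
    exact hy₀ p t (by omega) (by omega)
  have hxy : ∀ p, Φ.app c (x p) = W.map hac (y p) := by
    intro p
    rw [hy_def, W.map_map]
    exact hxy₀ p
  -- Since `b - a ≥ 2δ`, the path from `a + δ` to `d` passes through `b - δ`, where `g` becomes `k ∘
  -- Φ` and `Φ ∘ Ψ` is a structure map.
  have hgk : ∀ p (z : W.obj a), k p (W.map hab z) =
      g p (V.map (show a + δ ≤ d by omega) (Ψ.app a z)) := by
    intro p z
    have h1 : a ≤ a + δ + δ := by omega
    have h2 : a + δ ≤ b - δ := by omega
    have h3 : b - δ ≤ d := by omega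
    rw [hk, ← V.map_map h2 h3, ← hgk₀, Φ.app_map]
    refine congrArg (k₀ p) ?_
    refine Eq.trans ?_ (congrArg (W.map (add_le_add_left h2 (δ : ℤ))) (hΦΨ.2 a h1 z)).symm
    rw [W.map_map, W.map_map]
  have hΨy : ∀ p (h1 : a + δ ≤ c + 2 * δ) (h2 : c ≤ c + 2 * δ),
      V.map h1 (Ψ.app a (y p)) = V.map h2 (x p) := by
    intro p h1 h2
    have h3 : c ≤ c + δ + δ := by omega
    have h4 : c + δ + δ ≤ c + 2 * δ := by omega
    rw [← V.map_map h3 h4, ← hΦΨ.1 c h3, hxy, Ψ.app_map]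
    exact (V.map_map _ _ _).symm
  have hc2 : a + δ ≤ c + 2 * δ := by omega
  have hc2' : c ≤ c + 2 * δ := by omega
  have hΨyd : ∀ p t (h1 : a + δ ≤ t) (h2 : c ≤ t) (_ : c + 2 * δ ≤ t),
      V.map h1 (Ψ.app a (y p)) = V.map h2 (x p) := by
    intro p t h1 h2 h3
    rw [← V.map_map hc2 h3, hΨy p hc2 hc2', V.map_map]
  have hgx1 : ∀ p, g p (V.map hcd (x p)) = 1 := fun p => (hgx p p).trans (if_pos rfl)
  -- Otherwise `x p` would agree at `d ≥ c + 2δ` with `Ψ (y p)`, which is older than `c`, and `g p`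
  -- would vanish on it.
  have hca : c ≤ a + δ := by
    by_contra! hlt
    have h1 := hgx1 ⟨0, hpos⟩
    rw [← hΨyd _ d (by omega) hcd (by omega), hg _ _ hlt] at h1
    exact zero_ne_one h1
  -- Otherwise `Φ x` vanishes at `b + 1 - δ` in source indexing, so `x` vanishes 2δ later, at `b + 1
  -- + δ ≤ d`.
  have hdb : d ≤ b + δ := by
    by_contra! hlt
    have h1 := hgx1 ⟨0, hpos⟩
    have h2 : c ≤ b + 1 - δ := by omega
    have h3 : b + 1 - δ ≤ b + 1 - δ + δ + δ := by omega
    have h4 : b + 1 - δ + δ + δ ≤ d := by omega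
    have h5 : Φ.app _ (V.map h2 (x ⟨0, hpos⟩)) = 0 := by
      rw [Φ.app_map, hxy]
      refine (W.map_map _ _ _).trans (hy _ _ _ (by omega))
    rw [← V.map_map (h2.trans h3) h4, ← V.map_map h2 h3, ← hΦΨ.1 _ h3, h5, map_zero] at h1
    refine zero_ne_one (Eq.trans ?_ h1)
    exact ((congrArg (g _) (map_zero (V.map h4))).trans (map_zero _)).symm
  have hbar : V.HasBar c d := by
    refine ⟨hcd, x ⟨0, hpos⟩, hx _, fun s hs z hz => ?_⟩
    have h1 := hgx1 ⟨0, hpos⟩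
    rw [← hz, hg _ s hs] at h1
    exact zero_ne_one h1
  -- The difference of `Ψ (y p)` and `x p` dies by `c + 2δ ≤ d`. Born after `c`, it would start a
  -- bar strictly nested in `[c, d]` whose left endpoint is at most `a + δ ≤ c + 2δ`, against the
  -- gap.
  have hold : ∀ p, ∃ z : V.obj c, V.map hca z = Ψ.app a (y p) := by
    intro p
    by_cases hk0 : Ψ.app a (y p) - V.map hca (x p) = 0
    · exact ⟨x p, (sub_eq_zero.1 hk0).symm⟩
    obtain ⟨c', hc', k, hk, hmin⟩ := hV.exists_birth hk0
    rcases le_or_gt c' c with hle | hlt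
    · exact ⟨V.map hle k + x p, by rw [map_add, V.map_map, hk, sub_add_cancel]⟩
    obtain ⟨d', hd', hd't, hbar'⟩ := exists_hasBar (r := c' - 1) hc' hc2 k
      (fun r hr z => hk ▸ hmin r hr z) (by omega) 0
      (by rw [map_zero, ← V.map_map hc' hc2, hk, map_sub, V.map_map, hΨy p hc2 hc2', sub_self])
    have := (gV _ _ _ _ hbar' hbar hlt (by omega)).1
    push_cast at this
    omega
  have hO : Overlap (shiftBar ⟨(c, d), hcd⟩ δ) ⟨(a, b), hab⟩ := by
    refine ⟨?_, ?_, ?_⟩ <;> simp only [shiftBar] <;> omega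
  rw [multR, dif_pos hO]
  refine hΨ.le_mult hO y k g' hy
    (fun p s hs z => ?_) (fun p s hs z => ?_) (fun p z => ?_) (fun p => ?_) (fun p t ht hdt => ?_)
    (fun p q => ?_)
  · dsimp only at hs z ⊢
    obtain ⟨s, rfl⟩ : ∃ s', s = s' + δ := ⟨s - δ, by omega⟩
    rw [hk, W.map_map]
    exact hk₀ p s (by omega) z
  · dsimp only [shiftBar] at hs z ⊢
    exact (hg' p _).trans ((congrArg (g p) (V.map_map _ _ _)).trans
      (hg p (s + δ) (by omega) z))
  · dsimp only [shiftBar] at z ⊢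
    exact (hg' p _).trans ((congrArg (g p) (V.map_map _ _ _)).trans (hgk p z).symm)
  · dsimp only [shiftBar]
    obtain ⟨z, hz⟩ := hold p
    have h1 : c ≤ c - δ + δ := by omega
    exact ⟨V.map h1 z, (V.map_map _ _ _).trans hz⟩
  · dsimp only [shiftBar] at ht hdt ⊢
    exact (hΨyd p (t + δ) (by omega) (by omega) (by omega)).trans (hx p _ _ (by omega))
  · dsimp only
    rw [hgk, hΨyd q d (by omega) hcd (by omega)]
    exact hgx p q

end LadderModule

/-! ### The theorem for interleaving pairs -/

theorem mainTheorem3 {F : Type u} [Field F]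
    (V : PersistenceModule.{u, v} F) (W : PersistenceModule.{u, w} F)
    (hV : V.IsFinite) (hW : W.IsFinite) (δ : ℕ)
    (Φ : V.Hom (W.shift δ)) (Ψ : W.Hom (V.shift δ))
    (hΦΨ : PersistenceModule.IsInterleaving δ Φ Ψ)
    (hδ : 2 * (δ : ℕ∞) < min V.nestedness W.nestedness) :
    (∃ m, LadderModule.IsLadderDecomposition ⟨V, W.shift δ, Φ⟩ m) ∧
    (∃ m, LadderModule.IsLadderDecomposition ⟨W, V.shift δ, Ψ⟩ m) ∧
    ∀ mΦ mΨ : LadderModule.ElementaryType → ℕ,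
      LadderModule.IsLadderDecomposition ⟨V, W.shift δ, Φ⟩ mΦ →
      LadderModule.IsLadderDecomposition ⟨W, V.shift δ, Ψ⟩ mΨ →
      ∀ JV JW : NonemptyInterval ℤ, V.IsBar JV → W.IsBar JW →
        2 * (δ : ℤ) ≤ JV.length → 2 * (δ : ℤ) ≤ JW.length →
        ∀ μ : ℕ,
          LadderModule.multR mΦ (PersistenceModule.shiftBar JW δ) JV = μ ↔
          LadderModule.multR mΨ (PersistenceModule.shiftBar JV δ) JW = μ := by
  have hδ' : ((2 * δ : ℕ) : ℕ∞) < min V.nestedness W.nestedness := by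
    push_cast
    exact hδ
  have gV : V.NestedGap (2 * δ : ℕ) :=
    PersistenceModule.nestedGap_of_lt_nestedness hV (hδ'.trans_le (min_le_left _ _))
  have gW : W.NestedGap (2 * δ : ℕ) :=
    PersistenceModule.nestedGap_of_lt_nestedness hW (hδ'.trans_le (min_le_right _ _))
  have h0 : (0 : ℤ) ≤ (2 * δ : ℕ) := Int.natCast_nonneg _
  refine ⟨hΦΨ.almostIso.exists_isLadderDecomposition h0 hV (hW.shift δ) gV (gW.shift δ),
    hΦΨ.symm.almostIso.exists_isLadderDecomposition h0 hW (hV.shift δ) gW (gV.shift δ),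
    fun mΦ mΨ hΦ hΨ JV JW _ _ hJV hJW μ => ?_⟩
  rw [(LadderModule.multR_le_multR_of_isInterleaving hV gV hΦΨ hΦ hΨ JV JW hJV hJW).antisymm
    (LadderModule.multR_le_multR_of_isInterleaving hW gW hΦΨ.symm hΨ hΦ JW JV hJW hJV)]
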